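/- There are universal constants $C,a,b,\kappa,\delta>0$ such that the following holds for every real $0<\gamma<C$, every integer $d\ge a\ln(1/\gamma)$ and every real $\varepsilon$ with $\exp(-\exp(b\,d))\le\varepsilon\le C$. There exist a finite universe $\mathcal X$, a hypothesis set $\mathcal H\subseteq\{-1,1\}^{\mathcal X}$ of VC-dimension $d$, a probability distribution $\mathcal D$ over $\mathcal X$, and a $\gamma$-weak learner $\mathcal W$ with hypothesis set $\mathcal H$ for the constant concept $c\equiv 1$ (that is, for every probability distribution $\mathcal Q$ over $\mathcal X$, $\mathcal W$ returns a hypothesis $\mathcal W(\mathcal Q)\in\mathcal H$ with $\Pr_{x\sim \mathcal Q}[\mathcal W(\mathcal Q)(x)\ne c(x)]\le \tfrac12-\gamma$), such that AdaBoost run with $\mathcal W$ needs \[ m\;\ge\;\kappa\,\frac{d\,\ln(1/\varepsilon)}{\gamma^2\,\varepsilon} \] samples from $\mathcal D$ to output, with probability greater than $1-\delta$, a hypothesis with error at most $\varepsilon$ under $\mathcal D$. Precisely: for every sample size $1\le m<\kappa\, d\ln(1/\varepsilon)/(\gamma^2\varepsilon)$ and every number of rounds $T\ge1$, with probability at least $\delta$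 over $m$ independent samples $x_1,\dots,x_m\sim\mathcal D$, labelled by $c$, the output $h$ of AdaBoost after $T$ rounds satisfies $\Pr_{x\sim\mathcal D}[h(x)\ne c(x)]>\varepsilon$. Here AdaBoost starts with $\mathcal D^{(1)}_i=1/m$; in round $t$ it queries $\mathcal W$ with the distribution over $\mathcal X$ induced by the weights $\mathcal D^{(t)}$ on the samples, receives $h_t$ with weighted training error $e_t=\sum_{i:\,h_t(x_i)\ne c(x_i)}\mathcal D^{(t)}_i$, sets $w_t=\tfrac12\ln\frac{1-e_t}{e_t}$ and $\mathcal D^{(t+1)}_i\propto \mathcal D^{(t)}_i\exp(-w_t c(x_i)h_t(x_i))$, and it finally outputs $\operatorname{sign}\big(\sum_{t=1}^T w_th_t\big)$, with $\operatorname{sign}(0)=1$; if $e_t=0$ in some round (so that $w_t=+\infty$), it stops and outputs $h_t$. -/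

import Mathlib

open Finset

noncomputable section

/-- A hypothesis (or concept) on `X`: a map `X → {-1, 1}`, where `ℤˣ = {1, -1}`. -/
abbrev Hypothesis (X : Type) : Type := X → ℤˣ

/-- A real number attached to a label: `1` or `-1`. -/
def labelVal (y : ℤˣ) : ℝ := ((y : ℤ) : ℝ)

/-- The sign of a real number as a label, with `sign 0 = 1`. -/
def signLabel (r : ℝ) : ℤˣ := if 0 ≤ r then 1 else -1

/-- The VC-dimension of a hypothesis set: that of the family of the sets `{x | h x = 1}`. -/
def vcDimension {X : Type} [Fintype X] [DecidableEq X] (H : Finset (Hypothesis X)) : ℕ :=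
  (H.image fun h => univ.filter fun x => h x = 1).vcDim

/-- The error `Pr_{x ∼ D}[h x ≠ c x]` of the hypothesis `h` for the concept `c`, where `D` is given
by its probability mass function. -/
def predictionError {X : Type} [Fintype X] (D : X → ℝ) (c h : Hypothesis X) : ℝ :=
  ∑ x, if h x ≠ c x then D x else 0

/-- `W` is a `γ`-weak learner for the concept `c` with hypothesis set `H`: for every probability
distribution `D` over `X` it returns a hypothesis of `H` whose error under `D` is at most
`1 / 2 - γ`. (The value of `W` at functions that are not probability mass functions is
irrelevant.) -/
def IsWeakLearner {X : Type} [Fintype X] (γ : ℝ) (c : Hypothesis X) (H : Finset (Hypothesis X))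
    (W : (X → ℝ) → Hypothesis X) : Prop :=
  ∀ D ∈ stdSimplex ℝ X, W D ∈ H ∧ predictionError D c (W D) ≤ 1 / 2 - γ

/-- The distribution over `X` induced by the weights `p` on the examples of the training set. -/
def inducedDist {X : Type} [DecidableEq X] {m : ℕ} (S : Fin m → X × ℤˣ) (p : Fin m → ℝ) : X → ℝ :=
  fun x => ∑ i, if (S i).1 = x then p i else 0

/-- The error of `h` on the training set `S` weighted by `p`. -/
def trainingError {X : Type} {m : ℕ} (S : Fin m → X × ℤˣ) (p : Fin m → ℝ) (h : Hypothesis X) : ℝ :=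
  ∑ i, if h (S i).1 ≠ (S i).2 then p i else 0

/-- The weight that AdaBoost gives to a hypothesis of weighted training error `e`. -/
def adaWeight (e : ℝ) : ℝ := 1 / 2 * Real.log ((1 - e) / e)

/-- The update of the weights of the examples after a hypothesis `h` has received weight `w`. -/
def adaUpdate {X : Type} {m : ℕ} (S : Fin m → X × ℤˣ) (p : Fin m → ℝ) (w : ℝ)
    (h : Hypothesis X) : Fin m → ℝ :=
  fun i => p i * Real.exp (-w * labelVal (S i).2 * labelVal (h (S i).1)) /
    ∑ j, p j * Real.exp (-w * labelVal (S j).2 * labelVal (h (S j).1))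

/-- `T` rounds of AdaBoost with the weak learner `W` on the training set `S`, started at the
weights `p` on the examples and at the weighted vote `f` of the hypotheses found so far.
If a hypothesis makes no error on the training set, its weight would be `+∞`; then AdaBoost
stops and returns this hypothesis. -/
def adaBoostFrom {X : Type} [DecidableEq X] {m : ℕ} (W : (X → ℝ) → Hypothesis X)
    (S : Fin m → X × ℤˣ) : ℕ → (Fin m → ℝ) → (X → ℝ) → Hypothesis X
  | 0, _, f => fun x => signLabel (f x)
  | T + 1, p, f =>
    let h := W (inducedDist S p)
    let e := trainingError S p h
    if e = 0 then h
    else adaBoostFrom W S T (adaUpdate S p (adaWeight e) h)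
      (fun x => f x + adaWeight e * labelVal (h x))

/-- AdaBoost with the weak learner `W`, run for `T` rounds on the labelled training set `S`,
started at the uniform distribution over the `m` examples. -/
def adaBoost {X : Type} [DecidableEq X] {m : ℕ} (W : (X → ℝ) → Hypothesis X)
    (S : Fin m → X × ℤˣ) (T : ℕ) : Hypothesis X :=
  adaBoostFrom W S T (fun _ => 1 / (m : ℝ)) (fun _ => 0)

/-- The training set of the points `x 0, …, x (m - 1)` with their labels under the concept `c`. -/
def labelled {X : Type} {m : ℕ} (c : Hypothesis X) (x : Fin m → X) : Fin m → X × ℤˣ :=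
  fun i => (x i, c (x i))

open Classical in
/-- The probability of the event `P` over `m` independent samples from the distribution `D`. -/
def sampleProb {X : Type} [Fintype X] (D : X → ℝ) (m : ℕ) (P : (Fin m → X) → Prop) : ℝ :=
  ∑ x : Fin m → X, if P x then ∏ i, D (x i) else 0

end

open Finset

noncomputable section

/-! The domain is `Fin u` with the uniform distribution, where `u` is about `k / (128 ε)`, `k` is
about `d / (100 β²)` and `β = 4 γ`. As for a coupon collector, a sample smaller than a constant
times `u log (1 / ε)` is likely to miss a set `M` of `k` points. It suffices that AdaBoost errs on a
fraction `1 / 64` of `M`, since this is more than `ε u` points.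

The hypotheses are the rows of a random matrix with independent labels of mean `β`, arranged in `L`
groups of `R` rows. For fixed `M`, a row has total vote about `-β |M|` on `M` with probability `exp
(-O(β² k)) = exp (-O(d))`, so for `R = exp (d / 2)` each group is likely to contain such a row; the
first one is chosen. Outside `M` its labels still have mean `β`. So the average of the `L` chosen
rows has margin at least `β / 2` there, and every distribution that vanishes on `M` is served by one
of them with advantage `β / 4 = γ`. On `M` a chosen row behaves, up to a small density factor, like
independent labels of mean `-β` (`rowWeight_div_badProb_le`). So the sum of `N` chosen rows is at
most `-β N` on a constant fraction of `M`, with failure probability exponentially small in `k`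
(`expect_few_negVotes_of_dominated`). For `N` about `64 / β²` this survives a union bound over all
`L ^ N` tuples, because `N log L` is a small multiple of `k`, and Maurey's argument extends it to
all convex combinations (`card_neg_ge`).

AdaBoost keeps the weight of every sample point positive. Hence the weak learner reads the missed
points off the zero set of its input and can commit to the same `M` in every round. The output is
then a nonnegative vote of the chosen rows (`exists_adaBoostFrom_vote`), which is wrong on a large
part of `M`. Averaging over matrix and sample gives one matrix that works (`exists_matrix`).

The VC-dimension is controlled by counting: `L R + 1 ≤ 2 ^ d`, and further hypotheses are added
until it equals `d`. The lower bound on `ε` is due to the margin condition, which needs a union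
bound over the `u` points, each failing with probability `exp (-γ² L)`, where `L` is exponential in
`d`. -/

theorem sum_units_int (f : ℤˣ → ℝ) : ∑ y, f y = f 1 + f (-1) := by
  have : (univ : Finset ℤˣ) = {1, -1} := rfl
  rw [this, sum_pair (by decide)]

@[simp] theorem labelVal_one : labelVal 1 = 1 := by simp [labelVal]

@[simp] theorem labelVal_neg_one : labelVal (-1) = -1 := by simp [labelVal]

theorem labelVal_sq (y : ℤˣ) : labelVal y ^ 2 = 1 := by
  rcases Int.units_eq_one_or y with rfl | rfl <;> simp

/-! ### Expectations over independent coordinates. -/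

/-- The expectation of `f` when the coordinates are independent with weights `w i`. -/
def prodExpect {ι α : Type*} [Fintype ι] [DecidableEq ι] [Fintype α] (w : ι → α → ℝ)
    (f : (ι → α) → ℝ) : ℝ :=
  ∑ y : ι → α, (∏ i, w i (y i)) * f y

section prodExpect
variable {ι α : Type*} [Fintype ι] [DecidableEq ι] [Fintype α] {w : ι → α → ℝ}

theorem prodExpect_prod (φ : ι → α → ℝ) :
    prodExpect w (fun y => ∏ i, φ i (y i)) = ∏ i, ∑ a, w i a * φ i a := by
  simp only [prodExpect, ← prod_mul_distrib]
  rw [Finset.prod_univ_sum]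
  simp

theorem prodExpect_const (hw : ∀ i, ∑ a, w i a = 1) (c : ℝ) :
    prodExpect w (fun _ => c) = c := by
  have h := prodExpect_prod (w := w) (fun _ _ => 1)
  simp only [prod_const_one, mul_one, hw] at h
  have h2 : prodExpect w (fun _ => c) = c * prodExpect w (fun _ => 1) := by
    simp only [prodExpect, mul_sum]
    exact sum_congr rfl fun _ _ => by ring
  rw [h2, h, mul_one]

theorem prodExpect_mono (hw : ∀ i a, 0 ≤ w i a) {f g : (ι → α) → ℝ} (h : ∀ y, f y ≤ g y) :
    prodExpect w f ≤ prodExpect w g :=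
  sum_le_sum fun y _ => mul_le_mul_of_nonneg_left (h y) (prod_nonneg fun i _ => hw i _)

theorem prodExpect_add (f g : (ι → α) → ℝ) :
    prodExpect w (fun y => f y + g y) = prodExpect w f + prodExpect w g := by
  simp [prodExpect, mul_add, sum_add_distrib]

theorem prodExpect_sub (f g : (ι → α) → ℝ) :
    prodExpect w (fun y => f y - g y) = prodExpect w f - prodExpect w g := by
  simp [prodExpect, mul_sub, sum_sub_distrib]

theorem prodExpect_const_mul (c : ℝ) (f : (ι → α) → ℝ) :
    prodExpect w (fun y => c * f y) = c * prodExpect w f := by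
  simp only [prodExpect, mul_sum]
  exact sum_congr rfl fun _ _ => by ring

theorem prodExpect_sum {κ : Type*} (s : Finset κ) (f : κ → (ι → α) → ℝ) :
    prodExpect w (fun y => ∑ j ∈ s, f j y) = ∑ j ∈ s, prodExpect w (f j) := by
  simp only [prodExpect, mul_sum]
  exact sum_comm

/-- A function of one coordinate. -/
theorem prodExpect_eval (hw : ∀ i, ∑ a, w i a = 1) (j : ι) (φ : α → ℝ) :
    prodExpect w (fun y => φ (y j)) = ∑ a, w j a * φ a := by
  have h := prodExpect_prod (w := w) (fun i a => if i = j then φ a else 1)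
  simp only [prod_ite_eq', mem_univ, if_true] at h
  rw [h, ← mul_prod_erase univ _ (mem_univ j), prod_eq_one, mul_one]
  · simp
  · intro i hi
    simp [ne_of_mem_erase hi, hw]

/-- The coordinatewise image of independent coordinates. -/
theorem prodExpect_comp {β : Type*} [Fintype β] [DecidableEq β] (s : ι → α → β)
    (F : (ι → β) → ℝ) :
    prodExpect w (fun y => F fun i => s i (y i)) =
      prodExpect (fun i b => ∑ a, if s i a = b then w i a else 0) F := by
  simp only [prodExpect]
  have h : ∀ z : ι → β, (∏ i, ∑ a, if s i a = z i then w i a else 0) =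
      ∑ y : ι → α, if (fun i => s i (y i)) = z then ∏ i, w i (y i) else 0 := by
    intro z
    rw [Finset.prod_univ_sum, Fintype.piFinset_univ]
    refine sum_congr rfl fun y _ => ?_
    by_cases hz : (fun i => s i (y i)) = z
    · rw [if_pos hz]
      exact prod_congr rfl fun i _ => if_pos (congrFun hz i)
    · rw [if_neg hz]
      obtain ⟨i, hi⟩ := Function.ne_iff.mp hz
      exact prod_eq_zero (mem_univ i) (if_neg hi)
  simp only [h, sum_mul]
  rw [sum_comm]
  refine sum_congr rfl fun y _ => ?_
  simp [ite_mul]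

/-- The weights of coordinates on which `f` does not depend are irrelevant. -/
theorem prodExpect_congr_weight {w' : ι → α → ℝ} (I : ι → Prop) [DecidablePred I] (f : (ι → α) → ℝ)
    (hf : ∀ y z, (∀ i, I i → y i = z i) → f y = f z) (hw : ∀ i, ¬ I i → ∑ a, w i a = 1)
    (hw' : ∀ i, ¬ I i → ∑ a, w' i a = 1) (h : ∀ i, I i → w i = w' i) :
    prodExpect w f = prodExpect w' f := by
  classical
  rcases isEmpty_or_nonempty α with hα | ⟨⟨a₀⟩⟩
  · by_cases hI : ∀ i, I i
    · have : w = w' := funext fun i => h i (hI i)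
      rw [this]
    · obtain ⟨i, hi⟩ := not_forall.mp hI
      have := hw i hi
      simp at this
  · have key : ∀ v : ι → α → ℝ, (∀ i, ¬ I i → ∑ a, v i a = 1) → prodExpect v f =
        ∑ z : {i // I i} → α, (∏ i : {i // I i}, v i (z i)) *
          f (fun i => if hi : I i then z ⟨i, hi⟩ else a₀) := by
      intro v hv
      rw [prodExpect, ← (Equiv.piEquivPiSubtypeProd (I) (fun _ => α)).symm.sum_comp,
        Fintype.sum_prod_type]
      refine sum_congr rfl fun z _ => ?_
      have h1 : ∀ t : {i // ¬ I i} → α,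
          (∏ i, v i ((Equiv.piEquivPiSubtypeProd (I) (fun _ => α)).symm (z, t) i)) *
            f ((Equiv.piEquivPiSubtypeProd (I) (fun _ => α)).symm (z, t)) =
          ((∏ i : {i // I i}, v i (z i)) *
            f (fun i => if hi : I i then z ⟨i, hi⟩ else a₀)) * ∏ i : {i // ¬ I i}, v i (t i) := by
        intro t
        rw [hf _ (fun i => if hi : I i then z ⟨i, hi⟩ else a₀),
          ← Fintype.prod_subtype_mul_prod_subtype (I)]
        · have e1 : ∀ i : {i // I i}, (Equiv.piEquivPiSubtypeProd (I)
              (fun _ => α)).symm (z, t) i = z i := fun i => by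
            simp [Equiv.piEquivPiSubtypeProd, i.2]
          have e2 : ∀ i : {i // ¬ I i}, (Equiv.piEquivPiSubtypeProd (I)
              (fun _ => α)).symm (z, t) i = t i := fun i => by
            simp [Equiv.piEquivPiSubtypeProd, i.2]
          simp only [e1, e2]
          ac_rfl
        · intro i hi
          simp [Equiv.piEquivPiSubtypeProd, hi]
      simp only [h1]
      rw [← mul_sum]
      have h2 : ∑ t : {i // ¬ I i} → α, ∏ i : {i // ¬ I i}, v i (t i) = 1 := by
        have := prodExpect_prod (w := fun (i : {i // ¬ I i}) => v i) (fun _ _ => 1)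
        simp only [prodExpect, prod_const_one, mul_one] at this
        rw [this]
        exact prod_eq_one fun i _ => hv i i.2
      rw [h2, mul_one]
    rw [key w hw, key w' hw']
    refine sum_congr rfl fun z _ => ?_
    congr 1
    exact prod_congr rfl fun i _ => by rw [h i i.2]

end prodExpect

theorem prodExpect_succ {α : Type*} [Fintype α] {n : ℕ} (w : α → ℝ) (f : (Fin (n + 1) → α) → ℝ) :
    prodExpect (fun _ => w) f =
      ∑ a, w a * prodExpect (fun _ => w) (fun y : Fin n → α => f (Fin.cons a y)) := by
  rw [prodExpect, ← (Fin.consEquiv (fun _ : Fin (n + 1) => α)).sum_comp, Fintype.sum_prod_type]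
  refine sum_congr rfl fun a _ => ?_
  rw [prodExpect, mul_sum]
  refine sum_congr rfl fun y _ => ?_
  rw [Fin.prod_univ_succ]
  simp [Fin.consEquiv, mul_assoc]

/-- Rows and columns of a random matrix with independent entries. -/
theorem prodExpect_swap {ι κ α : Type*} [Fintype ι] [DecidableEq ι] [Fintype κ] [DecidableEq κ]
    [Fintype α] (w : κ → α → ℝ) (f : (ι → κ → α) → ℝ) :
    prodExpect (fun (_ : ι) (y : κ → α) => ∏ x, w x (y x)) f =
      prodExpect (fun (x : κ) (c : ι → α) => ∏ i, w x (c i)) (fun z => f fun i x => z x i) := by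
  simp only [prodExpect]
  rw [← (Equiv.piComm (fun (_ : ι) (_ : κ) => α)).symm.sum_comp]
  refine sum_congr rfl fun z _ => ?_
  simp only [Equiv.piComm_symm, Equiv.piComm_apply, Function.swap]
  rw [prod_comm]
  rfl

/-! ### Biased random labels and the moments of their weighted sums. -/

/-- The distribution of a random label of expectation `t`. -/
def signWeight (t : ℝ) (y : ℤˣ) : ℝ := (1 + t * labelVal y) / 2

theorem signWeight_sum (t : ℝ) : ∑ y, signWeight t y = 1 := by
  rw [sum_units_int]
  simp [signWeight]
  ring

theorem signWeight_nonneg {t : ℝ} (h1 : -1 ≤ t) (h2 : t ≤ 1) (y : ℤˣ) : 0 ≤ signWeight t y := by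
  rcases Int.units_eq_one_or y with rfl | rfl <;> simp [signWeight] <;> linarith

section moments
variable {ι α : Type*} [Fintype ι] [DecidableEq ι] [Fintype α] {w : ι → α → ℝ}

theorem prodExpect_add_sq (hw : ∀ i, ∑ a, w i a = 1) (t : ℝ) (Z : (ι → α) → ℝ) :
    prodExpect w (fun y => (t + Z y) ^ 2) =
      t ^ 2 + 2 * t * prodExpect w Z + prodExpect w (fun y => Z y ^ 2) := by
  rw [← prodExpect_const_mul]
  nth_rewrite 1 [← prodExpect_const hw (t ^ 2)]
  rw [← prodExpect_add, ← prodExpect_add]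
  congr 1
  ext y
  ring

theorem prodExpect_add_pow_four (hw : ∀ i, ∑ a, w i a = 1) (t : ℝ) (Z : (ι → α) → ℝ) :
    prodExpect w (fun y => (t + Z y) ^ 4) =
      t ^ 4 + 4 * t ^ 3 * prodExpect w Z + 6 * t ^ 2 * prodExpect w (fun y => Z y ^ 2) +
        4 * t * prodExpect w (fun y => Z y ^ 3) + prodExpect w (fun y => Z y ^ 4) := by
  rw [← prodExpect_const_mul, ← prodExpect_const_mul, ← prodExpect_const_mul]
  nth_rewrite 1 [← prodExpect_const hw (t ^ 4)]
  rw [← prodExpect_add, ← prodExpect_add, ← prodExpect_add, ← prodExpect_add]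
  congr 1
  ext y
  ring

end moments

/-- A centred weighted sum of labels. -/
def centredSum {n : ℕ} (β : ℝ) (a : Fin n → ℝ) (c : Fin n → ℤˣ) : ℝ :=
  ∑ l, a l * (labelVal (c l) + β)

theorem centredSum_cons {n : ℕ} (β : ℝ) (a : Fin (n + 1) → ℝ) (y : ℤˣ) (c : Fin n → ℤˣ) :
    centredSum β a (Fin.cons y c) =
      a 0 * (labelVal y + β) + centredSum β (fun l => a l.succ) c := by
  simp [centredSum, Fin.sum_univ_succ]

theorem expect_centredSum {n : ℕ} (β : ℝ) (a : Fin n → ℝ) :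
    prodExpect (fun _ => signWeight (-β)) (centredSum β a) = 0 := by
  induction n with
  | zero => simp [prodExpect, centredSum]
  | succ n ih =>
    have hw : ∀ i : Fin n, ∑ y, signWeight (-β) y = 1 := fun _ => signWeight_sum _
    rw [prodExpect_succ]
    simp only [centredSum_cons]
    have : ∀ y, prodExpect (fun _ : Fin n => signWeight (-β))
        (fun c => a 0 * (labelVal y + β) + centredSum β (fun l => a l.succ) c) =
        a 0 * (labelVal y + β) := fun y => by
      rw [prodExpect_add, prodExpect_const hw, ih, add_zero]
    simp only [this, sum_units_int, signWeight, labelVal_one, labelVal_neg_one]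
    ring

theorem expect_centredSum_sq {n : ℕ} (β : ℝ) (a : Fin n → ℝ) :
    prodExpect (fun _ => signWeight (-β)) (fun c => centredSum β a c ^ 2) =
      (1 - β ^ 2) * ∑ l, a l ^ 2 := by
  induction n with
  | zero => simp [prodExpect, centredSum]
  | succ n ih =>
    have hw : ∀ i : Fin n, ∑ y, signWeight (-β) y = 1 := fun _ => signWeight_sum _
    rw [prodExpect_succ]
    simp only [centredSum_cons, prodExpect_add_sq hw, ih, expect_centredSum]
    simp only [sum_units_int, signWeight, labelVal_one, labelVal_neg_one, Fin.sum_univ_succ]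
    ring

/-- The fourth central moment of one label is `(1 - β²) (1 + 3 β²)`. It is at most three times the
squared variance exactly when `β² ≤ 1 / 3` (or `β² = 1`), and this Gaussian-type bound is stable
under independent sums. -/
theorem expect_centredSum_pow_four {n : ℕ} {β : ℝ} (hβ : β ^ 2 ≤ 1 / 3) (a : Fin n → ℝ) :
    prodExpect (fun _ => signWeight (-β)) (fun c => centredSum β a c ^ 4) ≤
      3 * ((1 - β ^ 2) * ∑ l, a l ^ 2) ^ 2 := by
  induction n with
  | zero => simp [prodExpect, centredSum]
  | succ n ih =>
    have hw : ∀ i : Fin n, ∑ y, signWeight (-β) y = 1 := fun _ => signWeight_sum _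
    rw [prodExpect_succ]
    simp only [centredSum_cons, prodExpect_add_pow_four hw, expect_centredSum_sq,
      expect_centredSum]
    have ih' := ih (fun l => a l.succ)
    simp only [sum_units_int, signWeight, labelVal_one, labelVal_neg_one, Fin.sum_univ_succ]
    set E4 := prodExpect (fun _ => signWeight (-β))
      (fun c => centredSum β (fun l => a l.succ) c ^ 4)
    set s := ∑ l : Fin n, a l.succ ^ 2
    have h : 0 ≤ a 0 ^ 4 * (1 - β ^ 2) * (2 - 6 * β ^ 2) := by
      have h4 : 0 ≤ a 0 ^ 4 := by positivity
      exact mul_nonneg (mul_nonneg h4 (by linarith)) (by linarith)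
    nlinarith

/-- A centred weighted sum of independent labels is nonpositive with constant probability. -/
theorem expect_centredSum_nonpos {n : ℕ} {β : ℝ} (hβ : β ^ 2 ≤ 1 / 3) (a : Fin n → ℝ) :
    1 / 7 ≤ prodExpect (fun _ => signWeight (-β))
      (fun c => if centredSum β a c ≤ 0 then (1 : ℝ) else 0) := by
  have hw : ∀ i : Fin n, ∑ y, signWeight (-β) y = 1 := fun _ => signWeight_sum _
  have hβ1 : -1 ≤ -β := by nlinarith
  have hβ2 : -β ≤ 1 := by nlinarith
  have hw0 : ∀ (_ : Fin n) y, 0 ≤ signWeight (-β) y := fun _ => signWeight_nonneg hβ1 hβ2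
  set v := (1 - β ^ 2) * ∑ l, a l ^ 2 with hv
  have hs : 0 ≤ ∑ l, a l ^ 2 := sum_nonneg fun _ _ => sq_nonneg _
  have hv0 : 0 ≤ v := mul_nonneg (by linarith) hs
  rcases hs.eq_or_lt with h0 | hpos
  · have ha : ∀ l, a l = 0 := fun l => by
      have := (sum_eq_zero_iff_of_nonneg fun l _ => sq_nonneg (a l)).mp h0.symm l (mem_univ l)
      simpa using this
    have : ∀ c, centredSum β a c = 0 := fun c => by simp [centredSum, ha]
    simp only [this, le_refl, if_true, prodExpect_const hw]
    norm_num
  · have hvpos : 0 < v := mul_pos (by linarith) hpos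
    set r := Real.sqrt v with hr
    have hr2 : r ^ 2 = v := Real.sq_sqrt hv0
    have hr0 : 0 < r := Real.sqrt_pos.mpr hvpos
    -- Fourth moment method: a quartic without cubic term lies below `21 v²` times the indicator.
    -- Its expectation is at least `6 v² - 3 v² = 3 v²`, which gives the probability `3 / 21`.
    have key : ∀ c, -(6 * r ^ 3) * centredSum β a c + 6 * v * centredSum β a c ^ 2 +
        (-1) * centredSum β a c ^ 4 ≤
        21 * v ^ 2 * (if centredSum β a c ≤ 0 then (1 : ℝ) else 0) := by
      intro c
      set z := centredSum β a c
      rw [← hr2]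
      split_ifs with hz
      · have h1 : 0 ≤ (z ^ 2 - 4 * r ^ 2) ^ 2 := sq_nonneg _
        have h2 : 0 ≤ r ^ 2 * (2 * z ^ 2 + 6 * r * z + 5 * r ^ 2) :=
          mul_nonneg (sq_nonneg _) (by nlinarith [sq_nonneg (2 * z + 3 * r)])
        nlinarith
      · push Not at hz
        -- The cubic factor `(z - s)² (z + 2 s)` has no quadratic term; `s = 17 r / 12` makes its
        -- other coefficients close to `-6 r²` and `6 r³`.
        have h1 : 0 ≤ z * ((z - 17 / 12 * r) ^ 2 * (z + 17 / 6 * r)) := by positivity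
        have h2 : 0 ≤ z ^ 2 * r ^ 2 := by positivity
        have h3 : 0 ≤ z * r ^ 3 := by positivity
        nlinarith
    have h := prodExpect_mono (w := fun _ => signWeight (-β)) hw0 key
    rw [prodExpect_add, prodExpect_add, prodExpect_const_mul, prodExpect_const_mul,
      prodExpect_const_mul, prodExpect_const_mul, expect_centredSum, expect_centredSum_sq,
      ← hv] at h
    have h4 := expect_centredSum_pow_four hβ a
    rw [← hv] at h4
    by_contra! hc
    nlinarith [sq_pos_of_pos hvpos]

/-! ### Negative votes under the planted distribution. -/

/-- Independent labels: of expectation `-β` on `M`, of expectation `β` outside `M`. -/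
def plantedWeight {u : ℕ} (β : ℝ) (M : Finset (Fin u)) (x : Fin u) : ℤˣ → ℝ :=
  signWeight (if x ∈ M then -β else β)

theorem plantedWeight_sum {u : ℕ} (β : ℝ) (M : Finset (Fin u)) (x : Fin u) :
    ∑ y, plantedWeight β M x y = 1 := signWeight_sum _

theorem plantedWeight_nonneg {u : ℕ} {β : ℝ} (h0 : 0 ≤ β) (h1 : β ≤ 1) (M : Finset (Fin u))
    (x : Fin u) (y : ℤˣ) : 0 ≤ plantedWeight β M x y := by
  unfold plantedWeight
  split_ifs
  · exact signWeight_nonneg (by linarith) (by linarith) y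
  · exact signWeight_nonneg (by linarith) (by linarith) y

/-- The points of `M` on which the rows `i` of `Y` have a strongly negative vote. -/
def negVotes {u L N : ℕ} (β : ℝ) (M : Finset (Fin u)) (i : Fin N → Fin L)
    (Y : Fin L → Fin u → ℤˣ) : Finset (Fin u) :=
  M.filter fun x => ∑ n, labelVal (Y (i n) x) ≤ -β * N

theorem centredSum_eq_sum_comp {L N : ℕ} (β : ℝ) (i : Fin N → Fin L) (c : Fin L → ℤˣ) :
    centredSum β (fun l => ∑ n, if i n = l then (1 : ℝ) else 0) c =
      ∑ n, labelVal (c (i n)) + β * N := by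
  simp only [centredSum, sum_mul]
  rw [sum_comm]
  simp [sum_add_distrib, mul_comm]

/-- One factor of the Chernoff bound below: the vote at a point is strongly negative with
probability at least `1 / 7`, by `expect_centredSum_nonpos` with the multiplicities of the tuple as
coefficients. -/
theorem expect_half_pow_le {L N : ℕ} {β : ℝ} (hβ : β ^ 2 ≤ 1 / 3) (i : Fin N → Fin L) :
    prodExpect (fun _ => signWeight (-β))
      (fun c : Fin L → ℤˣ => if ∑ n, labelVal (c (i n)) ≤ -β * N then (1 / 2 : ℝ) else 1) ≤
        13 / 14 := by
  have h := expect_centredSum_nonpos hβ (fun l => ∑ n, if i n = l then (1 : ℝ) else 0)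
  simp only [centredSum_eq_sum_comp] at h
  have e : (fun c : Fin L → ℤˣ => if ∑ n, labelVal (c (i n)) ≤ -β * N then (1 / 2 : ℝ) else 1) =
      fun c => 1 - 1 / 2 * (if ∑ n, labelVal (c (i n)) + β * N ≤ 0 then (1 : ℝ) else 0) := by
    ext c
    have : (∑ n, labelVal (c (i n)) ≤ -β * N) ↔ (∑ n, labelVal (c (i n)) + β * N ≤ 0) := by
      constructor <;> intro h <;> linarith
    simp only [this]
    split_ifs <;> norm_num
  rw [e, prodExpect_sub, prodExpect_const_mul, prodExpect_const (fun _ => signWeight_sum _)]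
  linarith

/-- Chernoff's bound for a count of independent events. The columns of the matrix are independent,
so the expectation of `2 ^ (-count)` is at most `(13 / 14) ^ |M|`, which outweighs the Markov factor
`2 ^ (|M| / 32)`. -/
theorem expect_few_negVotes {u L N : ℕ} {β : ℝ} (h0 : 0 ≤ β) (hβ : β ^ 2 ≤ 1 / 3)
    (M : Finset (Fin u)) (i : Fin N → Fin L) :
    prodExpect (fun (_ : Fin L) (y : Fin u → ℤˣ) => ∏ x, plantedWeight β M x (y x))
      (fun Y => if ((negVotes β M i Y).card : ℝ) < M.card / 32 then (1 : ℝ) else 0) ≤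
      Real.exp (-(M.card / 32)) := by
  have h1 : β ≤ 1 := by nlinarith
  rw [prodExpect_swap]
  set φ : Fin u → (Fin L → ℤˣ) → ℝ := fun x c =>
    if x ∈ M ∧ ∑ n, labelVal (c (i n)) ≤ -β * N then (1 / 2 : ℝ) else 1 with hφ
  have hprod : ∀ z : Fin u → Fin L → ℤˣ, ∏ x, φ x (z x) =
      (1 / 2 : ℝ) ^ (negVotes β M i fun l x => z x l).card := by
    intro z
    simp only [hφ]
    rw [prod_ite, prod_const, prod_const_one, mul_one]
    congr 2
    ext x
    simp [negVotes]
  have hle : ∀ z : Fin u → Fin L → ℤˣ,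
      (if ((negVotes β M i fun l x => z x l).card : ℝ) < M.card / 32 then (1 : ℝ) else 0) ≤
        Real.exp (Real.log 2 * (M.card / 32)) * ∏ x, φ x (z x) := by
    intro z
    rw [hprod]
    have e : (1 / 2 : ℝ) ^ (negVotes β M i fun l x => z x l).card =
        Real.exp (-(Real.log 2 * (negVotes β M i fun l x => z x l).card)) := by
      rw [Real.exp_neg, mul_comm, Real.exp_nat_mul, Real.exp_log two_pos, one_div, inv_pow]
    rw [e, ← Real.exp_add]
    split_ifs with h
    · apply Real.one_le_exp
      have := mul_le_mul_of_nonneg_left h.le (Real.log_nonneg one_le_two)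
      linarith
    · positivity
  have hw : ∀ (x : Fin u) (c : Fin L → ℤˣ), 0 ≤ ∏ l, plantedWeight β M x (c l) :=
    fun x c => prod_nonneg fun l _ => plantedWeight_nonneg h0 h1 _ _ _
  refine (prodExpect_mono hw hle).trans ?_
  rw [prodExpect_const_mul, prodExpect_prod]
  have hfac : ∏ x, ∑ c : Fin L → ℤˣ, (∏ l, plantedWeight β M x (c l)) * φ x c ≤
      ∏ x, if x ∈ M then (13 / 14 : ℝ) else 1 := by
    apply prod_le_prod
    · intro x _
      refine sum_nonneg fun c _ => mul_nonneg (hw x c) ?_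
      simp only [hφ]
      split_ifs <;> norm_num
    · intro x _
      by_cases hx : x ∈ M
      · have := expect_half_pow_le hβ i
        simpa [hφ, hx, plantedWeight, prodExpect] using this
      · have := prodExpect_const (w := fun _ : Fin L => plantedWeight β M x)
          (fun _ => plantedWeight_sum _ _ _) 1
        simp only [hx, if_false, hφ, false_and]
        exact this.le
  rw [prod_ite_mem, univ_inter, prod_const] at hfac
  have h13 : (13 / 14 : ℝ) ≤ Real.exp (-(1 / 14)) := by
    have := Real.add_one_le_exp (-(1 / 14) : ℝ)
    linarith
  calc _ ≤ Real.exp (Real.log 2 * (M.card / 32)) * Real.exp (-(1 / 14)) ^ M.card := by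
        refine mul_le_mul_of_nonneg_left (hfac.trans ?_) (Real.exp_pos _).le
        exact pow_le_pow_left₀ (by norm_num) h13 _
    _ ≤ _ := by
        rw [← Real.exp_nat_mul, ← Real.exp_add]
        apply Real.exp_le_exp.mpr
        have hl := Real.log_two_lt_d9
        have hk : (0 : ℝ) ≤ M.card := Nat.cast_nonneg _
        nlinarith

/-- Change of measure at the price of one factor `K` per row. Only the at most `N` rows named by the
tuple matter; the others keep `law` and integrate to one, so the price is `K ^ N` and not `K ^ L`.
-/
theorem expect_few_negVotes_of_dominated {u L N : ℕ} {β : ℝ} (h0 : 0 ≤ β) (hβ : β ^ 2 ≤ 1 / 3)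
    (M : Finset (Fin u)) (i : Fin N → Fin L) (bad : (Fin u → ℤˣ) → Prop) [DecidablePred bad]
    (law : (Fin u → ℤˣ) → ℝ) (hlaw0 : ∀ y, 0 ≤ law y) (hlaw1 : ∑ y, law y = 1) {K : ℝ}
    (hK : 1 ≤ K) (hdom : ∀ y, bad y → law y ≤ K * ∏ x, plantedWeight β M x (y x)) :
    prodExpect (fun _ => law) (fun Y => if (∀ l, bad (Y l)) ∧
      ((negVotes β M i Y).card : ℝ) < M.card / 32 then (1 : ℝ) else 0) ≤
      K ^ N * Real.exp (-(M.card / 32)) := by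
  classical
  have h1 : β ≤ 1 := by nlinarith
  set Q : (Fin u → ℤˣ) → ℝ := fun y => ∏ x, plantedWeight β M x (y x) with hQ
  have hQ0 : ∀ y, 0 ≤ Q y := fun y => prod_nonneg fun x _ => plantedWeight_nonneg h0 h1 _ _ _
  have hQ1 : ∑ y, Q y = 1 := by
    have := prodExpect_const (w := fun x => plantedWeight β M x) (plantedWeight_sum β M) 1
    simpa [prodExpect] using this
  set I : Fin L → Prop := fun l => ∃ n, i n = l with hI
  set w : Fin L → (Fin u → ℤˣ) → ℝ := fun l => if I l then Q else law with hw
  set f : (Fin L → Fin u → ℤˣ) → ℝ := fun Y =>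
    if ((negVotes β M i Y).card : ℝ) < M.card / 32 then (1 : ℝ) else 0 with hf
  have hf0 : ∀ Y, 0 ≤ f Y := fun Y => by
    simp only [hf]
    split_ifs <;> norm_num
  have hcongr : prodExpect w f = prodExpect (fun _ => Q) f := by
    refine prodExpect_congr_weight I f ?_ ?_ (fun _ _ => hQ1) ?_
    · intro Y Z hYZ
      have : negVotes β M i Y = negVotes β M i Z := by
        unfold negVotes
        congr 1
        ext x
        rw [sum_congr rfl fun n _ => by rw [hYZ (i n) ⟨n, rfl⟩]]
      simp only [hf, this]
    · intro l hl
      simp only [hw, hl, if_false, hlaw1]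
    · intro l hl
      simp only [hw, hl, if_true]
  have hcard : (univ.filter I).card ≤ N := by
    have : univ.filter I ⊆ univ.image i := fun l hl => by
      obtain ⟨n, hn⟩ := (mem_filter.mp hl).2
      exact mem_image.mpr ⟨n, mem_univ _, hn⟩
    exact (card_le_card this).trans (card_image_le.trans (by simp))
  have hw0 : ∀ l y, 0 ≤ w l y := fun l y => by
    simp only [hw]
    split_ifs
    · exact hQ0 y
    · exact hlaw0 y
  calc _ ≤ K ^ N * prodExpect w f := by
        rw [prodExpect, prodExpect, mul_sum]
        refine sum_le_sum fun Y _ => ?_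
        by_cases hY : ∀ l, bad (Y l)
        · have : (if (∀ l, bad (Y l)) ∧ ((negVotes β M i Y).card : ℝ) < M.card / 32
              then (1 : ℝ) else 0) = f Y := by simp [hf, hY]
          rw [this, ← mul_assoc]
          refine mul_le_mul_of_nonneg_right ?_ (hf0 Y)
          calc ∏ l, law (Y l) ≤ ∏ l, (if I l then K else 1) * w l (Y l) := by
                refine prod_le_prod (fun l _ => hlaw0 _) fun l _ => ?_
                simp only [hw]
                split_ifs with hl
                · exact hdom _ (hY l)
                · rw [one_mul]
            _ = K ^ (univ.filter I).card * ∏ l, w l (Y l) := by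
                rw [prod_mul_distrib, prod_ite, prod_const, prod_const_one, mul_one]
            _ ≤ K ^ N * ∏ l, w l (Y l) :=
                mul_le_mul_of_nonneg_right (pow_le_pow_right₀ hK hcard)
                  (prod_nonneg fun l _ => hw0 l _)
        · have : ¬ ((∀ l, bad (Y l)) ∧ ((negVotes β M i Y).card : ℝ) < M.card / 32) :=
            fun h => hY h.1
          rw [if_neg this, mul_zero]
          exact mul_nonneg (by positivity)
            (mul_nonneg (prod_nonneg fun l _ => hw0 l _) (hf0 Y))
    _ ≤ _ := by
        rw [hcongr]
        exact mul_le_mul_of_nonneg_left (expect_few_negVotes h0 hβ M i) (by positivity)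

/-! ### Rejection sampling: the first of several trials that succeeds. -/

/-- The first of the `R` elements of `g` that satisfies `p`, and `d` if there is none. -/
def firstSat {α : Type*} (p : α → Prop) [DecidablePred p] (d : α) :
    (R : ℕ) → (Fin R → α) → α
  | 0, _ => d
  | R + 1, g => if p (g 0) then g 0 else firstSat p d R fun r => g r.succ

theorem firstSat_mem {α : Type*} (p : α → Prop) [DecidablePred p] (d : α) {R : ℕ}
    (g : Fin R → α) : firstSat p d R g = d ∨ ∃ r, firstSat p d R g = g r := by
  induction R with
  | zero => exact Or.inl rfl
  | succ R ih =>
    by_cases h : p (g 0)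
    · exact Or.inr ⟨0, by simp [firstSat, h]⟩
    · simp only [firstSat, h, if_false]
      rcases ih fun r => g r.succ with h' | ⟨r, hr⟩
      · exact Or.inl h'
      · exact Or.inr ⟨r.succ, hr⟩

/-- Conditioning on the first trial gives a geometric series in the failure probability, plus a term
for the default after `R` failures. -/
theorem expect_firstSat {α : Type*} [Fintype α] (p : α → Prop) [DecidablePred p]
    (d : α) (w : α → ℝ) (hw : ∑ a, w a = 1) (R : ℕ) (φ : α → ℝ) :
    prodExpect (fun _ => w) (fun g => φ (firstSat p d R g)) =
      (∑ j ∈ range R, (1 - ∑ a, if p a then w a else 0) ^ j) *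
        (∑ a, if p a then w a * φ a else 0) +
      (1 - ∑ a, if p a then w a else 0) ^ R * φ d := by
  set q := ∑ a, if p a then w a else 0 with hq
  set s := ∑ a, if p a then w a * φ a else 0 with hs
  induction R with
  | zero => simp [prodExpect, firstSat]
  | succ R ih =>
    rw [prodExpect_succ]
    set e := prodExpect (fun _ => w) (fun g => φ (firstSat p d R g)) with he
    have h : ∀ a, w a * prodExpect (fun _ => w) (fun y : Fin R → α =>
        φ (firstSat p d (R + 1) (Fin.cons a y))) =
        (if p a then w a * φ a else 0) + (w a * e - (if p a then w a else 0) * e) := by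
      intro a
      by_cases ha : p a
      · simp only [firstSat, Fin.cons_zero, ha, if_true]
        rw [prodExpect_const fun _ => hw]
        ring
      · simp only [firstSat, Fin.cons_zero, ha, if_false, Fin.cons_succ]
        rw [he]
        ring
    simp only [h, sum_add_distrib, sum_sub_distrib, ← sum_mul, hw, ← hq, ← hs]
    rw [ih, sum_range_succ']
    simp only [pow_succ, ← sum_mul]
    ring

section firstLaw
variable {α : Type*} [Fintype α] [DecidableEq α]

/-- The distribution of `firstSat`. -/
def firstLaw (p : α → Prop) [DecidablePred p] (d : α) (w : α → ℝ) (R : ℕ) (b : α) : ℝ :=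
  ∑ g : Fin R → α, if firstSat p d R g = b then ∏ r, w (g r) else 0

variable {p : α → Prop} [DecidablePred p] {d : α} {w : α → ℝ}

theorem firstLaw_nonneg (hw0 : ∀ a, 0 ≤ w a) (R : ℕ) (b : α) : 0 ≤ firstLaw p d w R b := by
  refine sum_nonneg fun g _ => ?_
  split_ifs
  · exact prod_nonneg fun r _ => hw0 _
  · exact le_rfl

theorem sum_firstLaw_mul (R : ℕ) (φ : α → ℝ) :
    ∑ b, firstLaw p d w R b * φ b = prodExpect (fun _ => w) (fun g => φ (firstSat p d R g)) := by
  simp only [firstLaw, prodExpect, sum_mul]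
  rw [sum_comm]
  refine sum_congr rfl fun g _ => ?_
  simp [ite_mul]

theorem sum_firstLaw (hw : ∑ a, w a = 1) (R : ℕ) : ∑ b, firstLaw p d w R b = 1 := by
  have h := sum_firstLaw_mul (p := p) (d := d) (w := w) R fun _ => 1
  rw [prodExpect_const fun _ => hw] at h
  simpa using h

theorem geom_sum_one_sub_le {q : ℝ} (hq0 : 0 < q) (hq1 : q ≤ 1) (R : ℕ) :
    ∑ j ∈ range R, (1 - q) ^ j ≤ 1 / q := by
  rw [le_div_iff₀ hq0]
  have h := geom_sum_mul_neg (1 - q) R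
  have : (0 : ℝ) ≤ (1 - q) ^ R := pow_nonneg (by linarith) R
  rw [sub_sub_cancel] at h
  linarith

theorem sum_ite_le_one {α : Type*} [Fintype α] {p : α → Prop} [DecidablePred p] {w : α → ℝ}
    (hw0 : ∀ a, 0 ≤ w a) (hw : ∑ a, w a = 1) :
    ∑ a, (if p a then w a else 0) ≤ 1 := by
  rw [← hw]
  refine sum_le_sum fun a _ => ?_
  split_ifs
  · exact le_rfl
  · exact hw0 a

/-- Among successful values the law is at most the conditional law given success: the default is not
successful, and the geometric series is at most `1 / q`. -/
theorem firstLaw_le (hw0 : ∀ a, 0 ≤ w a) (hw : ∑ a, w a = 1) (hd : ¬ p d)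
    (hq : 0 < ∑ a, if p a then w a else 0) (R : ℕ) {b : α} (hb : p b) :
    firstLaw p d w R b ≤ w b / ∑ a, if p a then w a else 0 := by
  have h := (sum_firstLaw_mul (p := p) (d := d) (w := w) R fun a => if a = b then 1 else 0).trans
    (expect_firstSat p d w hw R fun a => if a = b then 1 else 0)
  have hdb : d ≠ b := fun e => hd (e ▸ hb)
  have e : ∀ a, (if p a then w a * (if a = b then (1 : ℝ) else 0) else 0) =
      if a = b then w a else 0 := by
    intro a
    by_cases hab : a = b
    · simp [hab, hb]
    · simp [hab]
  rw [sum_congr rfl fun a _ => e a] at h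
  simp only [mul_ite, mul_one, mul_zero, sum_ite_eq', mem_univ, if_true, hdb, if_false,
    add_zero] at h
  rw [h, div_eq_mul_one_div, mul_comm]
  exact mul_le_mul_of_nonneg_left (geom_sum_one_sub_le hq (sum_ite_le_one hw0 hw) R) (hw0 b)

theorem sum_firstLaw_not (hw : ∑ a, w a = 1) (hd : ¬ p d) (R : ℕ) :
    ∑ b, firstLaw p d w R b * (if p b then (0 : ℝ) else 1) =
      (1 - ∑ a, if p a then w a else 0) ^ R := by
  refine (sum_firstLaw_mul R fun b => if p b then (0 : ℝ) else 1).trans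
    ((expect_firstSat p d w hw R fun b => if p b then (0 : ℝ) else 1).trans ?_)
  have : ∀ a, (if p a then w a * (if p a then (0 : ℝ) else 1) else 0) = 0 := fun a => by
    split_ifs <;> simp
  rw [sum_congr rfl fun a _ => this a]
  simp [hd]

/-- A bound for the expectation of `φ` after `firstSat`, from a bound for the conditional
expectation. -/
theorem sum_firstLaw_mul_le (hw0 : ∀ a, 0 ≤ w a) (hw : ∑ a, w a = 1)
    (R : ℕ) (φ : α → ℝ) {B : ℝ} (hdB : φ d ≤ B)
    (hB : ∑ a, (if p a then w a * φ a else 0) ≤ B * ∑ a, if p a then w a else 0) :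
    ∑ b, firstLaw p d w R b * φ b ≤ B := by
  rw [sum_firstLaw_mul, expect_firstSat p d w hw]
  set q := ∑ a, if p a then w a else 0
  have hq1 : q ≤ 1 := sum_ite_le_one hw0 hw
  have h0 : (0 : ℝ) ≤ (1 - q) ^ R := pow_nonneg (by linarith) R
  have hG : 0 ≤ ∑ j ∈ range R, (1 - q) ^ j := sum_nonneg fun j _ => pow_nonneg (by linarith) j
  have h := geom_sum_mul_neg (1 - q) R
  rw [sub_sub_cancel] at h
  calc _ ≤ (∑ j ∈ range R, (1 - q) ^ j) * (B * q) + (1 - q) ^ R * B :=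
        add_le_add (mul_le_mul_of_nonneg_left hB hG) (mul_le_mul_of_nonneg_left hdB h0)
    _ = ((∑ j ∈ range R, (1 - q) ^ j) * q) * B + (1 - q) ^ R * B := by ring
    _ = B := by rw [h]; ring

end firstLaw

/-! ### Bad rows and the exponential tilt on `M`. -/

/-- The density of a row of independent labels of expectation `β`. -/
def rowWeight {u : ℕ} (β : ℝ) (y : Fin u → ℤˣ) : ℝ := ∏ x, signWeight β (y x)

/-- The total vote of the row `y` on `M` is close to `-β |M|`. -/
def IsBad {u : ℕ} (β ζ : ℝ) (M : Finset (Fin u)) (y : Fin u → ℤˣ) : Prop :=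
  -((1 + ζ) * β * M.card) ≤ ∑ x ∈ M, labelVal (y x) ∧
    ∑ x ∈ M, labelVal (y x) ≤ -((1 - ζ) * β * M.card)

open Classical in
/-- The probability of `IsBad`. -/
def badProb {u : ℕ} (β ζ : ℝ) (M : Finset (Fin u)) : ℝ :=
  ∑ y, if IsBad β ζ M y then rowWeight β y else 0

theorem rowWeight_nonneg {u : ℕ} {β : ℝ} (h0 : 0 ≤ β) (h1 : β ≤ 1) (y : Fin u → ℤˣ) :
    0 ≤ rowWeight β y :=
  prod_nonneg fun _ _ => signWeight_nonneg (by linarith) h1 _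

theorem rowWeight_sum (u : ℕ) (β : ℝ) : ∑ y : Fin u → ℤˣ, rowWeight β y = 1 := by
  have := prodExpect_const (w := fun _ : Fin u => signWeight β) (fun _ => signWeight_sum _) 1
  simpa [prodExpect, rowWeight] using this

/-- The exponential tilt between labels of expectations `-β` and `β`. -/
def tilt (β : ℝ) : ℝ := Real.log ((1 + β) / (1 - β))

theorem tilt_nonneg {β : ℝ} (h0 : 0 ≤ β) (h1 : β < 1) : 0 ≤ tilt β :=
  Real.log_nonneg ((one_le_div (by linarith)).mpr (by linarith))

theorem tilt_le {β : ℝ} (h0 : 0 ≤ β) (h1 : β ≤ 1 / 3) : tilt β ≤ 3 * β := by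
  have hp : 0 < (1 + β) / (1 - β) := div_pos (by linarith) (by linarith)
  have h := Real.log_le_sub_one_of_pos hp
  refine h.trans ?_
  rw [div_sub_one (by linarith), div_le_iff₀ (by linarith)]
  nlinarith

theorem signWeight_eq_tilt {β : ℝ} (h0 : 0 ≤ β) (h1 : β < 1) (y : ℤˣ) :
    signWeight β y = signWeight (-β) y * Real.exp (tilt β * labelVal y) := by
  have hp : 0 < (1 + β) / (1 - β) := div_pos (by linarith) (by linarith)
  have ha : 1 + β ≠ 0 := by linarith
  have hb : 1 - β ≠ 0 := by linarith
  rcases Int.units_eq_one_or y with rfl | rfl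
  · simp only [signWeight, labelVal_one, mul_one, tilt, Real.exp_log hp]
    field_simp
    ring
  · simp only [signWeight, labelVal_neg_one, mul_neg, mul_one, Real.exp_neg, tilt,
      Real.exp_log hp]
    field_simp
    ring

theorem rowWeight_eq_tilt {u : ℕ} {β : ℝ} (h0 : 0 ≤ β) (h1 : β < 1) (M : Finset (Fin u))
    (y : Fin u → ℤˣ) :
    rowWeight β y =
      (∏ x, plantedWeight β M x (y x)) * Real.exp (tilt β * ∑ x ∈ M, labelVal (y x)) := by
  rw [mul_sum, Real.exp_sum, ← prod_filter_mul_prod_filter_not univ (· ∈ M)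
    (fun x => plantedWeight β M x (y x)), rowWeight,
    ← prod_filter_mul_prod_filter_not univ (· ∈ M)]
  have e : univ.filter (· ∈ M) = M := by ext; simp
  rw [e, mul_right_comm, ← prod_mul_distrib]
  congr 1
  · exact prod_congr rfl fun x hx => by
      rw [signWeight_eq_tilt h0 h1, plantedWeight, if_pos hx]
  · exact prod_congr rfl fun x hx => by
      rw [plantedWeight, if_neg (mem_filter.mp hx).2]

/-- The moment generating function of a centred label. -/
theorem sum_signWeight_mul_exp_le {β t : ℝ} (hβ0 : 0 ≤ β) (hβ1 : β ≤ 1) (ht : |t| ≤ 1 / 2) :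
    ∑ y, signWeight (-β) y * Real.exp (t * (labelVal y + β)) ≤ Real.exp (t ^ 2) := by
  have ht' := abs_le.mp ht
  have h : ∀ z : ℝ, |z| ≤ 1 → Real.exp z ≤ 1 + z + z ^ 2 := fun z hz => by
    have := (abs_le.mp (Real.abs_exp_sub_one_sub_id_le hz)).2
    linarith
  have e1 := h (t * (1 + β)) (by rw [abs_le]; constructor <;> nlinarith)
  have e2 := h (t * (-1 + β)) (by rw [abs_le]; constructor <;> nlinarith)
  have e3 := Real.add_one_le_exp (t ^ 2)
  rw [sum_units_int]
  simp only [signWeight, labelVal_one, labelVal_neg_one]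
  have m1 := mul_le_mul_of_nonneg_left e1 (show (0 : ℝ) ≤ (1 + -β * 1) / 2 by linarith)
  have m2 := mul_le_mul_of_nonneg_left e2 (show (0 : ℝ) ≤ (1 + -β * -1) / 2 by linarith)
  nlinarith [mul_nonneg (sq_nonneg t) (sq_nonneg β)]

theorem expect_planted_exp_le {u : ℕ} {β t : ℝ} (hβ0 : 0 ≤ β) (hβ1 : β ≤ 1) (ht : |t| ≤ 1 / 2)
    (M : Finset (Fin u)) :
    prodExpect (plantedWeight β M)
      (fun y => Real.exp (t * (∑ x ∈ M, labelVal (y x) + β * M.card))) ≤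
      Real.exp (t ^ 2 * M.card) := by
  have e : (fun y : Fin u → ℤˣ => Real.exp (t * (∑ x ∈ M, labelVal (y x) + β * M.card))) =
      fun y => ∏ x, (fun (x : Fin u) (a : ℤˣ) =>
        if x ∈ M then Real.exp (t * (labelVal a + β)) else 1) x (y x) := by
    ext y
    simp only
    rw [prod_ite_mem, univ_inter, ← Real.exp_sum, ← mul_sum, sum_add_distrib, sum_const,
      nsmul_eq_mul, mul_comm β]
  rw [e]
  refine (prodExpect_prod (w := plantedWeight β M) fun x a =>
    if x ∈ M then Real.exp (t * (labelVal a + β)) else 1).trans_le ?_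
  calc _ ≤ ∏ x, (if x ∈ M then Real.exp (t ^ 2) else 1) := by
        refine prod_le_prod (fun x _ => sum_nonneg fun a _ =>
          mul_nonneg (plantedWeight_nonneg hβ0 hβ1 M x a) ?_) fun x _ => ?_
        · split_ifs <;> positivity
        · by_cases hx : x ∈ M
          · simpa [hx, plantedWeight] using sum_signWeight_mul_exp_le hβ0 hβ1 ht
          · simp only [hx, if_false, mul_one, plantedWeight_sum]
            exact le_rfl
    _ = _ := by
        rw [prod_ite_mem, univ_inter, prod_const, ← Real.exp_nat_mul, mul_comm]

/-- Chernoff's bound for both tails with parameter `t = ζ β / 2`: each tail has probability at most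
`exp (-ζ² β² |M| / 4) ≤ exp (-2) ≤ 1 / 4`. -/
theorem half_le_expect_isBad {u : ℕ} {β ζ : ℝ} (hβ0 : 0 ≤ β) (hβ1 : β ≤ 1) (hζ0 : 0 ≤ ζ)
    (hζ1 : ζ ≤ 1) (M : Finset (Fin u)) (hM : 8 ≤ ζ ^ 2 * (β ^ 2 * M.card))
    [DecidablePred (IsBad β ζ M)] :
    1 / 2 ≤ prodExpect (plantedWeight β M) (fun y => if IsBad β ζ M y then (1 : ℝ) else 0) := by
  set t := ζ * β / 2 with ht
  have ht1 : |t| ≤ 1 / 2 := by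
    rw [abs_of_nonneg (by positivity)]
    nlinarith
  have ht2 : |-t| ≤ 1 / 2 := by rwa [abs_neg]
  set B := Real.exp (-(t * (ζ * β * M.card))) with hB
  have key : ∀ y : Fin u → ℤˣ, 1 - (B * Real.exp (t * (∑ x ∈ M, labelVal (y x) + β * M.card)) +
      B * Real.exp (-t * (∑ x ∈ M, labelVal (y x) + β * M.card))) ≤
      if IsBad β ζ M y then (1 : ℝ) else 0 := by
    intro y
    rw [hB, ← Real.exp_add, ← Real.exp_add]
    set s := ∑ x ∈ M, labelVal (y x)
    have p1 := Real.exp_pos (-(t * (ζ * β * M.card)) + t * (s + β * M.card))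
    have p2 := Real.exp_pos (-(t * (ζ * β * M.card)) + -t * (s + β * M.card))
    split_ifs with h
    · linarith
    · have ht0 : 0 ≤ t := by positivity
      rw [IsBad, not_and_or, not_le, not_le] at h
      rcases h with h | h
      · have : 1 ≤ Real.exp (-(t * (ζ * β * M.card)) + -t * (s + β * M.card)) := by
          apply Real.one_le_exp
          have : 0 ≤ t * (-(ζ * β * M.card) - (s + β * M.card)) :=
            mul_nonneg ht0 (by linarith)
          linarith
        linarith
      · have : 1 ≤ Real.exp (-(t * (ζ * β * M.card)) + t * (s + β * M.card)) := by
          apply Real.one_le_exp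
          have : 0 ≤ t * (-(ζ * β * M.card) + (s + β * M.card)) :=
            mul_nonneg ht0 (by linarith)
          linarith
        linarith
  refine le_trans ?_ (prodExpect_mono (fun x a => plantedWeight_nonneg hβ0 hβ1 M x a) key)
  rw [prodExpect_sub, prodExpect_const (plantedWeight_sum β M), prodExpect_add,
    prodExpect_const_mul, prodExpect_const_mul]
  have b1 := mul_le_mul_of_nonneg_left (expect_planted_exp_le hβ0 hβ1 ht1 M)
    (Real.exp_pos (-(t * (ζ * β * M.card)))).le
  have b2 := mul_le_mul_of_nonneg_left (expect_planted_exp_le hβ0 hβ1 ht2 M)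
    (Real.exp_pos (-(t * (ζ * β * M.card)))).le
  rw [neg_sq] at b2
  have hE : Real.exp (-(t * (ζ * β * M.card))) * Real.exp (t ^ 2 * M.card) ≤ 1 / 4 := by
    rw [← Real.exp_add]
    have e : -(t * (ζ * β * M.card)) + t ^ 2 * M.card = -(ζ ^ 2 * (β ^ 2 * M.card) / 4) := by
      rw [ht]; ring
    rw [e]
    have : Real.exp (-(ζ ^ 2 * (β ^ 2 * M.card) / 4)) ≤ Real.exp (-(2 * Real.log 2)) := by
      apply Real.exp_le_exp.mpr
      have := Real.log_two_lt_d9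
      linarith
    refine this.trans ?_
    rw [Real.exp_neg, two_mul, Real.exp_add, Real.exp_log two_pos]
    norm_num
  linarith

/-- Being bad is typical under the planted distribution. Tilting back to mean `β` costs at most the
exponential factor that the lower side of `IsBad` allows. -/
theorem badProb_ge {u : ℕ} {β ζ : ℝ} (hβ0 : 0 ≤ β) (hβ1 : β < 1) (hζ0 : 0 ≤ ζ)
    (hζ1 : ζ ≤ 1) (M : Finset (Fin u)) (hM : 8 ≤ ζ ^ 2 * (β ^ 2 * M.card)) :
    1 / 2 * Real.exp (-(tilt β * ((1 + ζ) * β * M.card))) ≤ badProb β ζ M := by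
  classical
  have h := half_le_expect_isBad hβ0 hβ1.le hζ0 hζ1 M hM
  refine (mul_le_mul_of_nonneg_right h (Real.exp_pos _).le).trans ?_
  rw [badProb, prodExpect, sum_mul]
  refine sum_le_sum fun y _ => ?_
  split_ifs with hy
  · rw [mul_one, rowWeight_eq_tilt hβ0 hβ1 M]
    refine mul_le_mul_of_nonneg_left (Real.exp_le_exp.mpr ?_)
      (prod_nonneg fun x _ => plantedWeight_nonneg hβ0 hβ1.le M x _)
    have := mul_le_mul_of_nonneg_left hy.1 (tilt_nonneg hβ0 hβ1)
    linarith
  · simp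

/-- A row conditioned to be bad is dominated by the planted distribution. The tilt depends only on
the total vote on `M`, which `IsBad` confines to a window of relative width `2 ζ`; the main
exponentials cancel and only the width remains. -/
theorem rowWeight_div_badProb_le {u : ℕ} {β ζ : ℝ} (hβ0 : 0 ≤ β) (hβ1 : β < 1) (hζ0 : 0 ≤ ζ)
    (hζ1 : ζ ≤ 1) (M : Finset (Fin u)) (hM : 8 ≤ ζ ^ 2 * (β ^ 2 * M.card)) {y : Fin u → ℤˣ}
    (hy : IsBad β ζ M y) :
    rowWeight β y / badProb β ζ M ≤
      2 * Real.exp (2 * tilt β * ζ * β * M.card) * ∏ x, plantedWeight β M x (y x) := by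
  have hq := badProb_ge hβ0 hβ1 hζ0 hζ1 M hM
  have hq0 : 0 < badProb β ζ M := lt_of_lt_of_le (by positivity) hq
  have hQ : 0 ≤ ∏ x, plantedWeight β M x (y x) :=
    prod_nonneg fun x _ => plantedWeight_nonneg hβ0 hβ1.le M x _
  rw [div_le_iff₀ hq0, rowWeight_eq_tilt hβ0 hβ1 M, mul_right_comm, mul_comm]
  refine mul_le_mul_of_nonneg_right ?_ hQ
  calc Real.exp (tilt β * ∑ x ∈ M, labelVal (y x)) ≤
        Real.exp (2 * tilt β * ζ * β * M.card + -(tilt β * ((1 + ζ) * β * M.card))) := by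
        apply Real.exp_le_exp.mpr
        have := mul_le_mul_of_nonneg_left hy.2 (tilt_nonneg hβ0 hβ1)
        linarith
    _ = 2 * Real.exp (2 * tilt β * ζ * β * M.card) *
        (1 / 2 * Real.exp (-(tilt β * ((1 + ζ) * β * M.card)))) := by
        rw [Real.exp_add]; ring
    _ ≤ _ := mul_le_mul_of_nonneg_left hq (by positivity)

/-! ### Most sets are good for a random matrix. -/

open Classical in
/-- In each group of rows, the first one that is bad for `M`. -/
def badRow {u L R : ℕ} (β ζ : ℝ) (M : Finset (Fin u)) (A : Fin L → Fin R → Fin u → ℤˣ) :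
    Fin L → Fin u → ℤˣ :=
  fun l => firstSat (IsBad β ζ M) (fun _ => 1) R (A l)

/-- The rows chosen for `M` have positive votes outside `M`, and small combinations of them have
negative votes on a large part of `M`. -/
structure IsGood {u L R : ℕ} (β ζ : ℝ) (N : ℕ) (M : Finset (Fin u))
    (A : Fin L → Fin R → Fin u → ℤˣ) : Prop where
  isBad : ∀ l, IsBad β ζ M (badRow β ζ M A l)
  margin : ∀ x ∉ M, β / 2 * L ≤ ∑ l, labelVal (badRow β ζ M A l x)
  negVotes : ∀ i : Fin N → Fin L, (M.card : ℝ) / 32 ≤ (negVotes β M i (badRow β ζ M A)).card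

/-- The expectation over a random matrix of labels of expectation `β`. -/
def matrixExpect {u L R : ℕ} (β : ℝ) (f : (Fin L → Fin R → Fin u → ℤˣ) → ℝ) : ℝ :=
  prodExpect (fun _ g => ∏ r, rowWeight β (g r)) f

open Classical in
/-- The distribution of `badRow`. -/
def badLaw {u : ℕ} (β ζ : ℝ) (R : ℕ) (M : Finset (Fin u)) : (Fin u → ℤˣ) → ℝ :=
  firstLaw (IsBad β ζ M) (fun _ => 1) (rowWeight β) R

theorem matrixExpect_badRow {u L R : ℕ} (β ζ : ℝ) (M : Finset (Fin u))
    (F : (Fin L → Fin u → ℤˣ) → ℝ) :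
    matrixExpect (R := R) β (fun A => F (badRow β ζ M A)) =
      prodExpect (fun _ => badLaw β ζ R M) F := by
  classical
  refine (prodExpect_comp (fun _ => firstSat (IsBad β ζ M) (fun _ => 1) R) F).trans ?_
  congr 1

/-- The reflection `y ↦ -y` of `sum_signWeight_mul_exp_le` at `t = β / 4`. The shift from `β` to `β
/ 2` contributes `-β² / 8`, of which half survives. -/
theorem sum_signWeight_mul_exp_neg_le {β : ℝ} (hβ0 : 0 ≤ β) (hβ1 : β ≤ 1) :
    ∑ y, signWeight β y * Real.exp (-(β / 4) * (labelVal y - β / 2)) ≤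
      Real.exp (-(β ^ 2 / 16)) := by
  have h := sum_signWeight_mul_exp_le (t := β / 4) hβ0 hβ1
    (by rw [abs_of_nonneg (by positivity)]; linarith)
  have h2 := mul_le_mul_of_nonneg_left h (Real.exp_pos (-(β ^ 2 / 8))).le
  rw [← Real.exp_add, sum_units_int, mul_add, mul_left_comm, ← Real.exp_add, mul_left_comm,
    ← Real.exp_add] at h2
  simp only [labelVal_one, labelVal_neg_one, signWeight] at h2
  rw [sum_units_int]
  simp only [labelVal_one, labelVal_neg_one, signWeight]
  rw [show -(β ^ 2 / 16) = -(β ^ 2 / 8) + (β / 4) ^ 2 by ring,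
    show -(β / 4) * (1 - β / 2) = -(β ^ 2 / 8) + β / 4 * (-1 + β) by ring,
    show -(β / 4) * (-1 - β / 2) = -(β ^ 2 / 8) + β / 4 * (1 + β) by ring]
  linarith

/-- Being bad for `M` is independent of the label of a point outside `M`. -/
theorem sum_isBad_mul {u : ℕ} {β : ℝ} (ζ : ℝ) (M : Finset (Fin u)) {x : Fin u} (hx : x ∉ M)
    [DecidablePred (IsBad β ζ M)] (φ : ℤˣ → ℝ) (hc : ∑ a, signWeight β a * φ a ≠ 0) :
    ∑ y, (if IsBad β ζ M y then rowWeight β y * φ (y x) else 0) =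
      (∑ a, signWeight β a * φ a) * ∑ y, if IsBad β ζ M y then rowWeight β y else 0 := by
  set c := ∑ a, signWeight β a * φ a with hcdef
  -- The factor `φ (y x) / c` is absorbed into the weight of the coordinate `x`, which still has
  -- total one; `IsBad` does not see this coordinate.
  set w : Fin u → ℤˣ → ℝ := fun i a => if i = x then signWeight β a * φ a / c
    else signWeight β a with hw
  have h := prodExpect_congr_weight (w := w) (w' := fun _ => signWeight β) (fun i => i ≠ x)
    (fun y => if IsBad β ζ M y then (1 : ℝ) else 0) ?_ ?_ (fun _ _ => signWeight_sum _) ?_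
  · have e1 : ∑ y, (if IsBad β ζ M y then rowWeight β y else 0) =
        prodExpect (fun _ => signWeight β) (fun y => if IsBad β ζ M y then (1 : ℝ) else 0) := by
      simp [prodExpect, rowWeight]
    rw [e1, ← h, prodExpect, mul_sum]
    refine sum_congr rfl fun y _ => ?_
    split_ifs
    · have : ∏ i, w i (y i) = (∏ i, signWeight β (y i)) * (φ (y x) / c) := by
        rw [← mul_prod_erase univ _ (mem_univ x), ← mul_prod_erase univ (fun i =>
          signWeight β (y i)) (mem_univ x)]
        have : ∏ i ∈ univ.erase x, w i (y i) = ∏ i ∈ univ.erase x, signWeight β (y i) :=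
          prod_congr rfl fun i hi => by simp [hw, ne_of_mem_erase hi]
        rw [this]
        simp only [hw, if_true]
        ring
      rw [this, rowWeight]
      field_simp
    · simp
  · intro y z hyz
    have : IsBad β ζ M y ↔ IsBad β ζ M z := by
      unfold IsBad
      rw [sum_congr rfl fun i hi => by rw [hyz i fun e => hx (e ▸ hi)]]
    simp only [this]
  · intro i hi
    rw [not_not] at hi
    simp only [hw, hi, if_true]
    rw [← sum_div, ← hcdef, div_self hc]
  · intro i hi
    ext a
    simp [hw, hi]

section
variable {u L R N : ℕ} {β ζ : ℝ} {M : Finset (Fin u)}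

open Classical in
theorem badLaw_nonneg (hβ0 : 0 ≤ β) (hβ1 : β ≤ 1) (y : Fin u → ℤˣ) : 0 ≤ badLaw β ζ R M y :=
  firstLaw_nonneg (rowWeight_nonneg hβ0 hβ1) R y

open Classical in
theorem badLaw_sum : ∑ y, badLaw β ζ R M y = 1 := sum_firstLaw (rowWeight_sum u β) R

theorem not_isBad_one (hβ0 : 0 ≤ β) (hζ1 : ζ ≤ 1) (hM : 0 < M.card) :
    ¬ IsBad β ζ M fun _ => 1 := by
  intro h
  have h2 := h.2
  simp only [labelVal_one, sum_const, nsmul_eq_mul, mul_one] at h2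
  have : (0 : ℝ) < M.card := by exact_mod_cast hM
  have : 0 ≤ (1 - ζ) * β * M.card := mul_nonneg (mul_nonneg (by linarith) hβ0) this.le
  linarith

open Classical in
theorem expect_exists_not_isBad (hβ0 : 0 ≤ β) (hβ1 : β ≤ 1) (hζ1 : ζ ≤ 1) (hM : 0 < M.card) :
    prodExpect (fun _ : Fin L => badLaw β ζ R M)
      (fun Y => if ∃ l, ¬ IsBad β ζ M (Y l) then (1 : ℝ) else 0) ≤
      L * (1 - badProb β ζ M) ^ R := by
  have h : ∀ Y : Fin L → Fin u → ℤˣ, (if ∃ l, ¬ IsBad β ζ M (Y l) then (1 : ℝ) else 0) ≤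
      ∑ l, (fun (l : Fin L) (Y : Fin L → Fin u → ℤˣ) =>
        if IsBad β ζ M (Y l) then (0 : ℝ) else 1) l Y := by
    intro Y
    have h0 : ∀ l, 0 ≤ if IsBad β ζ M (Y l) then (0 : ℝ) else 1 := fun l => by
      split_ifs <;> norm_num
    split_ifs with hY
    · obtain ⟨l, hl⟩ := hY
      refine le_trans ?_ (single_le_sum (fun l _ => h0 l) (mem_univ l))
      simp [hl]
    · exact sum_nonneg fun l _ => h0 l
  refine (prodExpect_mono (fun _ => badLaw_nonneg hβ0 hβ1) h).trans ?_
  rw [prodExpect_sum]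
  refine le_of_eq ?_
  have h2 : ∀ l : Fin L, prodExpect (fun _ : Fin L => badLaw β ζ R M)
      (fun Y => if IsBad β ζ M (Y l) then (0 : ℝ) else 1) = (1 - badProb β ζ M) ^ R := by
    intro l
    refine (prodExpect_eval (fun _ => badLaw_sum) l
      fun y => if IsBad β ζ M y then (0 : ℝ) else 1).trans ?_
    exact sum_firstLaw_not (rowWeight_sum u β) (not_isBad_one hβ0 hζ1 hM) R
  rw [sum_congr rfl fun l _ => h2 l]
  simp

/-- Chernoff's bound over the `L` independent groups; selecting a row by its values on `M` does not
bias its label at `x ∉ M`. -/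
theorem expect_small_margin (hβ0 : 0 ≤ β) (hβ1 : β ≤ 1) {x : Fin u} (hx : x ∉ M) :
    prodExpect (fun _ : Fin L => badLaw β ζ R M)
      (fun Y => if ∑ l, labelVal (Y l x) < β / 2 * L then (1 : ℝ) else 0) ≤
      Real.exp (-(β ^ 2 / 16 * L)) := by
  classical
  set φ : ℤˣ → ℝ := fun a => Real.exp (-(β / 4) * (labelVal a - β / 2)) with hφ
  have h : ∀ Y : Fin L → Fin u → ℤˣ,
      (if ∑ l, labelVal (Y l x) < β / 2 * L then (1 : ℝ) else 0) ≤
      ∏ l, (fun (_ : Fin L) (y : Fin u → ℤˣ) => φ (y x)) l (Y l) := by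
    intro Y
    simp only [hφ]
    rw [← Real.exp_sum, ← mul_sum, sum_sub_distrib, sum_const, nsmul_eq_mul, card_univ,
      Fintype.card_fin]
    split_ifs with hY
    · apply Real.one_le_exp
      nlinarith
    · positivity
  refine (prodExpect_mono (fun _ => badLaw_nonneg hβ0 hβ1) h).trans ?_
  refine (prodExpect_prod (w := fun _ : Fin L => badLaw β ζ R M) fun _ y => φ (y x)).trans_le ?_
  rw [prod_const, card_univ, Fintype.card_fin,
    show -(β ^ 2 / 16 * L) = L * -(β ^ 2 / 16) by ring, Real.exp_nat_mul]
  have hc := sum_signWeight_mul_exp_neg_le hβ0 hβ1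
  have hc0 : 0 < ∑ a, signWeight β a * φ a := by
    rw [sum_units_int]
    have h1 : 0 < signWeight β 1 := by simp [signWeight]; linarith
    have h2 := signWeight_nonneg (t := β) (by linarith) hβ1 (-1)
    have := mul_pos h1 (Real.exp_pos (-(β / 4) * (labelVal 1 - β / 2)))
    have := mul_nonneg h2 (Real.exp_pos (-(β / 4) * (labelVal (-1) - β / 2))).le
    simp only [hφ]
    linarith
  refine pow_le_pow_left₀ (sum_nonneg fun y _ =>
    mul_nonneg (badLaw_nonneg hβ0 hβ1 y) (Real.exp_pos _).le) ?_ _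
  refine sum_firstLaw_mul_le (rowWeight_nonneg hβ0 hβ1) (rowWeight_sum u β) R
    (fun y => φ (y x)) ?_ ?_
  -- The default row satisfies the bound as well, because its label at `x` is `1`.
  · simp only [hφ, labelVal_one]
    apply Real.exp_le_exp.mpr
    nlinarith
  · rw [sum_isBad_mul ζ M hx φ hc0.ne']
    refine mul_le_mul_of_nonneg_right hc (sum_nonneg fun y _ => ?_)
    split_ifs
    · exact rowWeight_nonneg hβ0 hβ1 y
    · exact le_rfl

open Classical in
/-- A set is good for a random matrix with high probability. -/
theorem matrixExpect_not_isGood_le (hβ0 : 0 ≤ β) (hβ1 : β ≤ 1 / 3) (hζ0 : 0 ≤ ζ)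
    (hζ1 : ζ ≤ 1) (hM : 8 ≤ ζ ^ 2 * (β ^ 2 * M.card)) :
    matrixExpect β (fun A : Fin L → Fin R → Fin u → ℤˣ =>
        if IsGood β ζ N M A then (0 : ℝ) else 1) ≤
      L * (1 - badProb β ζ M) ^ R + u * Real.exp (-(β ^ 2 / 16 * L)) +
        L ^ N * ((2 * Real.exp (2 * tilt β * ζ * β * M.card)) ^ N *
          Real.exp (-(M.card / 32))) := by
  have hβ' : β < 1 := by linarith
  have hM0 : 0 < M.card := by
    rcases Nat.eq_zero_or_pos M.card with h | h
    · rw [h] at hM; norm_num at hM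
    · exact h
  -- Union bound over the three ways to fail. The last one includes that all rows are bad, because
  -- only bad rows are dominated by the planted distribution.
  set F : (Fin L → Fin u → ℤˣ) → ℝ := fun Y =>
    (if ∃ l, ¬ IsBad β ζ M (Y l) then (1 : ℝ) else 0) +
    (∑ x ∈ univ.filter (· ∉ M), if ∑ l, labelVal (Y l x) < β / 2 * L then (1 : ℝ) else 0) +
    ∑ i : Fin N → Fin L, if (∀ l, IsBad β ζ M (Y l)) ∧
      ((negVotes β M i Y).card : ℝ) < M.card / 32 then (1 : ℝ) else 0 with hF
  have hle : ∀ A : Fin L → Fin R → Fin u → ℤˣ,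
      (if IsGood β ζ N M A then (0 : ℝ) else 1) ≤ F (badRow β ζ M A) := by
    intro A
    simp only [hF]
    set Y := badRow β ζ M A with hY
    have h1 : (0 : ℝ) ≤ if ∃ l, ¬ IsBad β ζ M (Y l) then (1 : ℝ) else 0 := by
      split_ifs <;> norm_num
    have h2' : ∀ x : Fin u, (0 : ℝ) ≤
        if ∑ l, labelVal (Y l x) < β / 2 * L then (1 : ℝ) else 0 := fun x => by
      split_ifs <;> norm_num
    have h2 : (0 : ℝ) ≤ ∑ x ∈ univ.filter (· ∉ M),
        if ∑ l, labelVal (Y l x) < β / 2 * L then (1 : ℝ) else 0 := sum_nonneg fun x _ => h2' x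
    have h3' : ∀ i : Fin N → Fin L, (0 : ℝ) ≤ if (∀ l, IsBad β ζ M (Y l)) ∧
      ((negVotes β M i Y).card : ℝ) < M.card / 32 then (1 : ℝ) else 0 := fun i => by
      split_ifs <;> norm_num
    have h3 : (0 : ℝ) ≤ ∑ i : Fin N → Fin L, if (∀ l, IsBad β ζ M (Y l)) ∧
      ((negVotes β M i Y).card : ℝ) < M.card / 32 then (1 : ℝ) else 0 := sum_nonneg fun i _ => h3' i
    by_cases hg : IsGood β ζ N M A
    · rw [if_pos hg]
      positivity
    · rw [if_neg hg]
      by_cases hb : ∃ l, ¬ IsBad β ζ M (Y l)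
      · rw [if_pos hb]
        linarith
      by_cases hm : ∃ x ∉ M, ∑ l, labelVal (Y l x) < β / 2 * L
      · obtain ⟨x, hx, hlt⟩ := hm
        have := single_le_sum (f := fun x => if ∑ l, labelVal (Y l x) < β / 2 * L then (1 : ℝ)
          else 0) (fun x _ => h2' x) (s := univ.filter (· ∉ M)) (a := x) (by simp [hx])
        simp only [hlt, if_true] at this
        linarith
      by_cases hn : ∃ i : Fin N → Fin L, ((negVotes β M i Y).card : ℝ) < M.card / 32
      · obtain ⟨i, hi⟩ := hn
        have := single_le_sum (f := fun i : Fin N → Fin L => if (∀ l, IsBad β ζ M (Y l)) ∧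
          ((negVotes β M i Y).card : ℝ) < M.card / 32 then (1 : ℝ) else 0)
          (fun i _ => h3' i) (mem_univ i)
        have hb' : ∀ l, IsBad β ζ M (Y l) := by
          push Not at hb
          exact hb
        beta_reduce at this
        rw [if_pos ⟨hb', hi⟩] at this
        linarith
      · push Not at hb hm hn
        exact absurd ⟨hb, hm, hn⟩ hg
  have hw : ∀ (_ : Fin L) (g : Fin R → Fin u → ℤˣ), 0 ≤ ∏ r, rowWeight β (g r) :=
    fun _ g => prod_nonneg fun r _ => rowWeight_nonneg hβ0 hβ'.le _
  refine (prodExpect_mono hw hle).trans ?_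
  refine (matrixExpect_badRow β ζ M F).trans_le ?_
  rw [hF, prodExpect_add, prodExpect_add, prodExpect_sum, prodExpect_sum]
  refine add_le_add (add_le_add (expect_exists_not_isBad hβ0 hβ'.le hζ1 hM0) ?_) ?_
  · calc _ ≤ ∑ x ∈ univ.filter (· ∉ M), Real.exp (-(β ^ 2 / 16 * L)) :=
          sum_le_sum fun x hx => expect_small_margin hβ0 hβ'.le (mem_filter.mp hx).2
      _ ≤ _ := by
          rw [sum_const, nsmul_eq_mul]
          refine mul_le_mul_of_nonneg_right ?_ (Real.exp_pos _).le
          exact_mod_cast (card_le_univ _).trans (by simp)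
  · have hq0 : 0 < badProb β ζ M :=
      lt_of_lt_of_le (by positivity) (badProb_ge hβ0 hβ' hζ0 hζ1 M hM)
    have hK : (1 : ℝ) ≤ 2 * Real.exp (2 * tilt β * ζ * β * M.card) := by
      have : 1 ≤ Real.exp (2 * tilt β * ζ * β * M.card) := by
        apply Real.one_le_exp
        have := tilt_nonneg hβ0 hβ'
        positivity
      linarith
    calc _ ≤ ∑ _i : Fin N → Fin L, ((2 * Real.exp (2 * tilt β * ζ * β * M.card)) ^ N *
          Real.exp (-(M.card / 32))) := by
          refine sum_le_sum fun i _ => ?_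
          refine expect_few_negVotes_of_dominated hβ0 (by nlinarith) M i (IsBad β ζ M)
            (badLaw β ζ R M) (badLaw_nonneg hβ0 hβ'.le) badLaw_sum hK fun y hy => ?_
          refine (firstLaw_le (rowWeight_nonneg hβ0 hβ'.le) (rowWeight_sum u β)
            (not_isBad_one hβ0 hζ1 hM0) hq0 R hy).trans ?_
          exact rowWeight_div_badProb_le hβ0 hβ' hζ0 hζ1 M hM hy
      _ = _ := by
          rw [sum_const, nsmul_eq_mul, card_univ]
          simp
end

/-! ### From small uniform votes to all convex combinations. -/

/-- Maurey's sampling argument: a convex combination is close to a uniform combination of few of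
the vectors. -/
theorem exists_tuple_close {κ : Type*} {L : ℕ} (M : Finset κ) (V : Fin L → κ → ℝ)
    (hV : ∀ l, ∀ x ∈ M, V l x ^ 2 ≤ 1) (a : Fin L → ℝ) (ha : ∀ l, 0 ≤ a l) (ha1 : ∑ l, a l = 1)
    (N : ℕ) :
    ∃ i : Fin N → Fin L,
      ∑ x ∈ M, (∑ n, V (i n) x - N * ∑ l, a l * V l x) ^ 2 ≤ N * M.card := by
  set v : κ → ℝ := fun x => ∑ l, a l * V l x with hv
  induction N with
  | zero => exact ⟨Fin.elim0, by simp⟩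
  | succ N ih =>
    obtain ⟨i, hi⟩ := ih
    set D : κ → ℝ := fun x => ∑ n, V (i n) x - N * v x with hD
    -- If the next index is drawn with probabilities `a`, the cross term vanishes and each squared
    -- deviation grows by a variance, which is at most `1`.
    have hmean : ∑ l, a l * ∑ x ∈ M, (D x + (V l x - v x)) ^ 2 ≤
        ∑ l, a l * ((N + 1 : ℝ) * M.card) := by
      have h1 : ∀ x, ∑ l, a l * (D x + (V l x - v x)) ^ 2 =
          D x ^ 2 + ∑ l, a l * V l x ^ 2 - v x ^ 2 := by
        intro x
        have e : ∀ l, a l * (D x + (V l x - v x)) ^ 2 =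
            a l * (D x - v x) ^ 2 + 2 * (D x - v x) * (a l * V l x) + a l * V l x ^ 2 := by
          intro l; ring
        rw [sum_congr rfl fun l _ => e l, sum_add_distrib, sum_add_distrib, ← sum_mul, ha1,
          ← mul_sum]
        change 1 * (D x - v x) ^ 2 + 2 * (D x - v x) * v x + _ = _
        ring
      simp only [mul_sum]
      rw [sum_comm]
      have h2 : ∀ x ∈ M, ∑ l, a l * (D x + (V l x - v x)) ^ 2 ≤ D x ^ 2 + 1 := by
        intro x hx
        rw [h1]
        have : ∑ l, a l * V l x ^ 2 ≤ ∑ l, a l := sum_le_sum fun l _ =>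
          mul_le_of_le_one_right (ha l) (hV l x hx)
        nlinarith [sq_nonneg (v x)]
      refine (sum_le_sum h2).trans ?_
      rw [sum_add_distrib, sum_const, nsmul_eq_mul, mul_one, ← sum_mul, ha1]
      linarith
    obtain ⟨l, hl⟩ : ∃ l, ∑ x ∈ M, (D x + (V l x - v x)) ^ 2 ≤ (N + 1 : ℝ) * M.card := by
      by_contra! hc
      have hne : ∃ l, 0 < a l := by
        by_contra! h0
        have : ∑ l, a l ≤ 0 := sum_nonpos fun l _ => h0 l
        linarith
      obtain ⟨l₀, hl₀⟩ := hne
      have := sum_lt_sum (s := univ) (fun l _ => mul_le_mul_of_nonneg_left (hc l).le (ha l))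
        ⟨l₀, mem_univ _, mul_lt_mul_of_pos_left (hc l₀) hl₀⟩
      linarith
    refine ⟨Fin.cons l i, ?_⟩
    push_cast
    refine le_trans (le_of_eq (sum_congr rfl fun x _ => ?_)) hl
    simp only [hD, Fin.sum_univ_succ, Fin.cons_zero, Fin.cons_succ]
    ring

/-- If all small uniform combinations of the rows of `Y` have many negative votes on `M`, then
all convex combinations have. -/
theorem card_neg_ge {u L N : ℕ} {β : ℝ} (hβ : 0 < β) (hN : 64 ≤ N * β ^ 2) (M : Finset (Fin u))
    (Y : Fin L → Fin u → ℤˣ)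
    (hY : ∀ i : Fin N → Fin L, (M.card : ℝ) / 32 ≤ (negVotes β M i Y).card)
    (a : Fin L → ℝ) (ha : ∀ l, 0 ≤ a l) (ha1 : 0 < ∑ l, a l) :
    (M.card : ℝ) / 64 ≤ (M.filter fun x => ∑ l, a l * labelVal (Y l x) < 0).card := by
  set A := ∑ l, a l with hA
  obtain ⟨i, hi⟩ := exists_tuple_close M (fun l x => labelVal (Y l x))
    (fun l x _ => (labelVal_sq _).le) (fun l => a l / A) (fun l => div_nonneg (ha l) ha1.le)
    (by rw [← sum_div, ← hA, div_self ha1.ne']) N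
  set v : Fin u → ℝ := fun x => ∑ l, a l / A * labelVal (Y l x) with hv
  have hvneg : ∀ x, v x < 0 → ∑ l, a l * labelVal (Y l x) < 0 := by
    intro x hx
    have : ∑ l, a l * labelVal (Y l x) = A * v x := by
      rw [hv, mul_sum]
      refine sum_congr rfl fun l _ => ?_
      field_simp
    rw [this]
    exact mul_neg_of_pos_of_neg ha1 hx
  set G := negVotes β M i Y with hG
  have hsub : G ⊆ (M.filter fun x => ∑ l, a l * labelVal (Y l x) < 0) ∪
      G.filter fun x => 0 ≤ v x := by
    intro x hx
    rcases lt_or_ge (v x) 0 with h | h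
    · exact mem_union_left _ (mem_filter.mpr ⟨(mem_filter.mp hx).1, hvneg x h⟩)
    · exact mem_union_right _ (mem_filter.mpr ⟨hx, h⟩)
  have hcard : (G.card : ℝ) ≤ (M.filter fun x => ∑ l, a l * labelVal (Y l x) < 0).card +
      (G.filter fun x => 0 ≤ v x).card := by
    exact_mod_cast (card_le_card hsub).trans (card_union_le _ _)
  have hN0 : (0 : ℝ) < N := by
    by_contra! h
    have := mul_nonpos_of_nonpos_of_nonneg h (sq_nonneg β)
    linarith
  -- At a point of `G` the sampled vote is at most `-β N`; if moreover `v x ≥ 0`, the deviation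
  -- there is at least `β N`. With `N β² ≥ 64` this leaves at most `|M| / 64` such points.
  have hbound : ((G.filter fun x => 0 ≤ v x).card : ℝ) * (β * N) ^ 2 ≤ N * M.card := by
    refine le_trans ?_ hi
    rw [← nsmul_eq_mul, ← sum_const]
    refine (sum_le_sum fun x hx => ?_).trans (sum_le_sum_of_subset_of_nonneg
      ((filter_subset _ _).trans (filter_subset _ _)) fun x _ _ => sq_nonneg _)
    have h1 := (mem_filter.mp (mem_filter.mp hx).1).2
    have h2 := (mem_filter.mp hx).2
    have h3 : 0 ≤ N * v x := mul_nonneg hN0.le h2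
    have h4 : 0 ≤ β * N := by positivity
    rw [← neg_sq (_ - _)]
    refine pow_le_pow_left₀ h4 ?_ 2
    change β * N ≤ -(∑ n, labelVal (Y (i n) x) - N * v x)
    linarith
  have hsmall : ((G.filter fun x => 0 ≤ v x).card : ℝ) ≤ M.card / 64 := by
    have h0 : (0 : ℝ) ≤ (G.filter fun x => 0 ≤ v x).card := Nat.cast_nonneg _
    have h1 : ((G.filter fun x => 0 ≤ v x).card : ℝ) * (N * β ^ 2) ≤ M.card := by
      have : N * (((G.filter fun x => 0 ≤ v x).card : ℝ) * (N * β ^ 2)) ≤ N * M.card := by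
        linarith
      exact le_of_mul_le_mul_left this hN0
    nlinarith
  have := hY i
  rw [← hG] at this
  linarith

/-! ### The output of AdaBoost as a vote of the chosen rows. -/

section adaBoost
variable {u m : ℕ}

theorem adaWeight_pos {e : ℝ} (h0 : 0 < e) (h1 : e < 1 / 2) : 0 < adaWeight e := by
  unfold adaWeight
  have : 0 < Real.log ((1 - e) / e) := Real.log_pos (by rw [one_lt_div h0]; linarith)
  linarith

theorem adaUpdate_pos {X : Type} (S : Fin m → X × ℤˣ) {p : Fin m → ℝ} (hp : ∀ i, 0 < p i)
    (w : ℝ) (h : Hypothesis X) (i : Fin m) : 0 < adaUpdate S p w h i := by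
  unfold adaUpdate
  exact div_pos (mul_pos (hp i) (Real.exp_pos _))
    (sum_pos (fun j _ => mul_pos (hp j) (Real.exp_pos _)) ⟨i, mem_univ i⟩)

theorem adaUpdate_sum {X : Type} (S : Fin m → X × ℤˣ) {p : Fin m → ℝ} (hp : ∀ i, 0 < p i)
    (w : ℝ) (h : Hypothesis X) (hm : 0 < m) : ∑ i, adaUpdate S p w h i = 1 := by
  unfold adaUpdate
  rw [← sum_div]
  exact div_self (sum_pos (fun j _ => mul_pos (hp j) (Real.exp_pos _)) ⟨⟨0, hm⟩, mem_univ _⟩).ne'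

theorem inducedDist_mem_stdSimplex {X : Type} [Fintype X] [DecidableEq X] (S : Fin m → X × ℤˣ)
    {p : Fin m → ℝ} (hp : ∀ i, 0 ≤ p i) (h1 : ∑ i, p i = 1) :
    inducedDist S p ∈ stdSimplex ℝ X := by
  refine ⟨fun x => sum_nonneg fun i _ => ?_, ?_⟩
  · split_ifs
    · exact hp i
    · exact le_rfl
  · simp only [inducedDist]
    rw [sum_comm]
    simp [h1]

theorem inducedDist_eq_zero_iff {X : Type} [DecidableEq X] (S : Fin m → X × ℤˣ)
    {p : Fin m → ℝ} (hp : ∀ i, 0 < p i) (x : X) :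
    inducedDist S p x = 0 ↔ ∀ i, (S i).1 ≠ x := by
  unfold inducedDist
  rw [sum_eq_zero_iff_of_nonneg fun i _ => by split_ifs; exacts [(hp i).le, le_rfl]]
  refine ⟨fun h i hi => ?_, fun h i _ => if_neg (h i)⟩
  have := h i (mem_univ i)
  rw [if_pos hi] at this
  exact (hp i).ne' this

theorem trainingError_labelled {X : Type} [Fintype X] [DecidableEq X] (c h : Hypothesis X)
    (x : Fin m → X) (p : Fin m → ℝ) :
    trainingError (labelled c x) p h = predictionError (inducedDist (labelled c x) p) c h := by
  unfold trainingError predictionError inducedDist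
  have : ∀ z : X, (if h z ≠ c z then ∑ i, (if ((labelled c x) i).1 = z then p i else 0) else 0) =
      ∑ i, if x i = z then (if h z ≠ c z then p i else 0) else 0 := by
    intro z
    split_ifs with hz
    · rfl
    · simp
  rw [sum_congr rfl fun z _ => this z, sum_comm]
  refine sum_congr rfl fun i _ => ?_
  by_cases hi : h (x i) = c (x i) <;> simp [labelled, hi]

/-- If the weak learner only returns hypotheses `Y l`, then AdaBoost errs where a nonnegative
combination of them is negative. -/
theorem exists_adaBoostFrom_vote {L : ℕ} {W : (Fin u → ℝ) → Hypothesis (Fin u)}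
    (x : Fin m → Fin u) (hm : 0 < m) (Y : Fin L → Hypothesis (Fin u)) {γ : ℝ} (hγ : 0 < γ)
    (hW : ∀ p : Fin m → ℝ, (∀ i, 0 < p i) → ∑ i, p i = 1 →
      (∃ l, W (inducedDist (labelled (fun _ => 1) x) p) = Y l) ∧
      predictionError (inducedDist (labelled (fun _ => 1) x) p) (fun _ => 1)
        (W (inducedDist (labelled (fun _ => 1) x) p)) ≤ 1 / 2 - γ) (T : ℕ) :
    ∀ (p : Fin m → ℝ), (∀ i, 0 < p i) → ∑ i, p i = 1 → ∀ a : Fin L → ℝ, (∀ l, 0 ≤ a l) →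
      (1 ≤ T ∨ 0 < ∑ l, a l) → ∃ b : Fin L → ℝ, (∀ l, 0 ≤ b l) ∧ 0 < ∑ l, b l ∧
      ∀ z, ∑ l, b l * labelVal (Y l z) < 0 →
        adaBoostFrom W (labelled (fun _ => 1) x) T p (fun z => ∑ l, a l * labelVal (Y l z)) z ≠
          1 := by
  induction T with
  | zero =>
    intro p _ _ a ha hT
    -- With no round left, some weight is already positive, so the vote is not trivial. Strict
    -- negativity is needed because `signLabel 0 = 1`.
    refine ⟨a, ha, hT.resolve_left (by norm_num), fun z hz => ?_⟩
    simp only [adaBoostFrom, signLabel, not_le.mpr hz, if_false]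
    decide
  | succ T ih =>
    intro p hp hp1 a ha _
    obtain ⟨⟨l₀, hl₀⟩, herr⟩ := hW p hp hp1
    rw [← trainingError_labelled] at herr
    by_cases he : trainingError (labelled (fun _ => 1) x) p
        (W (inducedDist (labelled (fun _ => 1) x) p)) = 0
    -- Early stop: the output is one row, which is the vote concentrated on it.
    · refine ⟨Pi.single l₀ 1, fun l => ?_, by simp, fun z hz => ?_⟩
      · by_cases h : l = l₀
        · subst h; simp
        · simp [h]
      · rw [hl₀] at he
        simp only [adaBoostFrom, hl₀, he, if_true]
        simp only [Pi.single_apply, ite_mul, one_mul, zero_mul, sum_ite_eq', mem_univ,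
          if_true] at hz
        intro h1
        rw [h1, labelVal_one] at hz
        linarith
    · simp only [adaBoostFrom, he, if_false]
      set e := trainingError (labelled (fun _ => 1) x) p
        (W (inducedDist (labelled (fun _ => 1) x) p)) with hedef
      have he0 : 0 ≤ e := by
        rw [hedef]
        refine sum_nonneg fun i _ => ?_
        split_ifs
        · exact (hp i).le
        · exact le_rfl
      -- The advantage `γ > 0` keeps the training error below `1 / 2`, so the new weight is
      -- positive.
      have hw := adaWeight_pos (lt_of_le_of_ne he0 (Ne.symm he)) (by linarith)
      have hb : ∀ l, 0 ≤ a l + if l = l₀ then adaWeight e else 0 := fun l => by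
        have := ha l
        split_ifs <;> linarith
      have hsum : 0 < ∑ l, (a l + if l = l₀ then adaWeight e else 0) := by
        rw [sum_add_distrib]
        have := sum_nonneg fun l (_ : l ∈ univ) => ha l
        simp only [sum_ite_eq', mem_univ, if_true]
        linarith
      obtain ⟨b, hb0, hb1, hbz⟩ := ih
        (adaUpdate (labelled (fun _ => 1) x) p (adaWeight e)
          (W (inducedDist (labelled (fun _ => 1) x) p)))
        (adaUpdate_pos _ hp _ _) (adaUpdate_sum _ hp _ _ hm)
        (fun l => a l + if l = l₀ then adaWeight e else 0) hb (Or.inr hsum)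
      refine ⟨b, hb0, hb1, fun z hz => ?_⟩
      have hf : (fun z => ∑ l, a l * labelVal (Y l z) + adaWeight e *
          labelVal (W (inducedDist (labelled (fun _ => 1) x) p) z)) =
          fun z => ∑ l, (a l + if l = l₀ then adaWeight e else 0) * labelVal (Y l z) := by
        ext z
        simp [add_mul, sum_add_distrib, hl₀]
      rw [hf]
      exact hbz z hz

end adaBoost

/-! ### Samples that miss many points. -/

section sampleProb
variable {X : Type} [Fintype X]

theorem sampleProb_mono {D : X → ℝ} (hD : ∀ x, 0 ≤ D x) {m : ℕ} {P Q : (Fin m → X) → Prop}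
    (h : ∀ x, P x → Q x) : sampleProb D m P ≤ sampleProb D m Q := by
  refine sum_le_sum fun x _ => ?_
  by_cases hP : P x
  · rw [if_pos hP, if_pos (h x hP)]
  · rw [if_neg hP]
    split_ifs
    · exact prod_nonneg fun i _ => hD _
    · exact le_rfl

theorem sampleProb_succ_le {D : X → ℝ} (hD : ∀ x, 0 ≤ D x) (hD1 : ∑ x, D x = 1) {m : ℕ}
    {P : (Fin (m + 1) → X) → Prop} {Q : (Fin m → X) → Prop}
    (h : ∀ a x, P (Fin.cons a x) → Q x) : sampleProb D (m + 1) P ≤ sampleProb D m Q := by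
  classical
  rw [sampleProb, ← (Fin.consEquiv (fun _ : Fin (m + 1) => X)).sum_comp, Fintype.sum_prod_type]
  have : ∀ a, ∑ x : Fin m → X, (if P (Fin.consEquiv (fun _ : Fin (m + 1) => X) (a, x)) then
      ∏ i, D (Fin.consEquiv (fun _ : Fin (m + 1) => X) (a, x) i) else 0) ≤
      D a * sampleProb D m Q := by
    intro a
    rw [sampleProb, mul_sum]
    refine sum_le_sum fun x _ => ?_
    have hp : 0 ≤ ∏ i, D (x i) := prod_nonneg fun i _ => hD _
    simp only [Fin.consEquiv, Equiv.coe_fn_mk, Fin.prod_univ_succ, Fin.cons_zero, Fin.cons_succ]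
    by_cases hP : P (Fin.cons a x)
    · have h1 : (if P (Fin.cons a x) then D a * ∏ i, D (x i) else 0) = D a * ∏ i, D (x i) :=
        if_pos hP
      rw [if_pos (h a x hP)]
      exact h1.le
    · have h1 : (if P (Fin.cons a x) then D a * ∏ i, D (x i) else 0) = 0 := if_neg hP
      refine h1.le.trans (mul_nonneg (hD a) ?_)
      split_ifs
      · exact hp
      · exact le_rfl
  refine (sum_le_sum fun a _ => this a).trans ?_
  rw [← sum_mul, hD1, one_mul]

/-- Events that avoid the sample are less likely for larger samples. -/
theorem sampleProb_avoid_antitone [DecidableEq X] {D : X → ℝ} (hD : ∀ x, 0 ≤ D x)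
    (hD1 : ∑ x, D x = 1) (G : Finset X → Prop) {m m' : ℕ} (hm : m ≤ m') :
    sampleProb D m' (fun x => ∃ M, G M ∧ ∀ i, x i ∉ M) ≤
      sampleProb D m (fun x => ∃ M, G M ∧ ∀ i, x i ∉ M) := by
  induction m', hm using Nat.le_induction with
  | base => exact le_rfl
  | succ m' _ ih =>
    refine le_trans ?_ ih
    refine sampleProb_succ_le hD hD1 ?_
    rintro a x ⟨M, hG, hM⟩
    exact ⟨M, hG, fun i => by simpa using hM i.succ⟩

end sampleProb

theorem prodExpect_indicator_avoid {u m : ℕ} (hu : 0 < u) (S : Finset (Fin u)) :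
    prodExpect (fun (_ : Fin m) (_ : Fin u) => 1 / (u : ℝ))
      (fun x => if ∀ i, x i ∉ S then (1 : ℝ) else 0) = (1 - S.card / u) ^ m := by
  have e : (fun x : Fin m → Fin u => if ∀ i, x i ∉ S then (1 : ℝ) else 0) =
      fun x => ∏ i, (fun (_ : Fin m) (z : Fin u) => if z ∈ S then (0 : ℝ) else 1) i (x i) := by
    ext x
    split_ifs with h
    · exact (prod_eq_one fun i _ => if_neg (h i)).symm
    · push Not at h
      obtain ⟨i, hi⟩ := h
      have : ∏ i, (if x i ∈ S then (0 : ℝ) else 1) = 0 := prod_eq_zero (mem_univ i) (if_pos hi)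
      exact this.symm
  rw [e]
  refine (prodExpect_prod (w := fun (_ : Fin m) (_ : Fin u) => 1 / (u : ℝ))
    (fun _ z => if z ∈ S then (0 : ℝ) else 1)).trans ?_
  rw [prod_const, card_univ, Fintype.card_fin, ← mul_sum]
  congr 1
  have hu' : (u : ℝ) ≠ 0 := by exact_mod_cast hu.ne'
  have : ∑ z : Fin u, (if z ∈ S then (0 : ℝ) else 1) = u - S.card := by
    have h1 : ∀ z : Fin u, (if z ∈ S then (0 : ℝ) else 1) = 1 - if z ∈ S then 1 else 0 :=
      fun z => by split_ifs <;> simp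
    rw [sum_congr rfl fun z _ => h1 z, sum_sub_distrib]
    simp
  rw [this]
  field_simp

/-- The number of points missed by the sample `x`. -/
def missed {u m : ℕ} (x : Fin m → Fin u) : Finset (Fin u) := univ.filter fun z => ∀ i, x i ≠ z

theorem card_missed_eq {u m : ℕ} (x : Fin m → Fin u) :
    ((missed x).card : ℝ) = ∑ z, if ∀ i, x i ≠ z then (1 : ℝ) else 0 := by
  simp [missed]

theorem expect_card_missed {u m : ℕ} (hu : 0 < u) :
    prodExpect (fun (_ : Fin m) (_ : Fin u) => 1 / (u : ℝ)) (fun x => ((missed x).card : ℝ)) =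
      u * (1 - 1 / u) ^ m := by
  simp only [card_missed_eq]
  rw [prodExpect_sum]
  have h : ∀ z : Fin u, prodExpect (fun (_ : Fin m) (_ : Fin u) => 1 / (u : ℝ))
      (fun x => if ∀ i, x i ≠ z then (1 : ℝ) else 0) = (1 - 1 / u) ^ m := by
    intro z
    have := prodExpect_indicator_avoid (m := m) hu {z}
    simpa using this
  rw [sum_congr rfl fun z _ => h z]
  simp

/-- The events that two distinct points are missed are negatively correlated, because `1 - 2 / u ≤
(1 - 1 / u)²`. So the variance is at most the mean. -/
theorem expect_card_missed_sq_le {u m : ℕ} (hu : 0 < u) :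
    prodExpect (fun (_ : Fin m) (_ : Fin u) => 1 / (u : ℝ)) (fun x => ((missed x).card : ℝ) ^ 2) ≤
      u * (1 - 1 / u) ^ m + (u * (1 - 1 / u) ^ m) ^ 2 := by
  have hu' : (0 : ℝ) < u := by exact_mod_cast hu
  have hsq : ∀ x : Fin m → Fin u, ((missed x).card : ℝ) ^ 2 =
      ∑ z, ∑ t, if ∀ i, x i ∉ ({z, t} : Finset (Fin u)) then (1 : ℝ) else 0 := by
    intro x
    rw [card_missed_eq, sq, sum_mul_sum]
    refine sum_congr rfl fun z _ => sum_congr rfl fun t _ => ?_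
    have : (∀ i, x i ∉ ({z, t} : Finset (Fin u))) ↔ (∀ i, x i ≠ z) ∧ ∀ i, x i ≠ t := by
      simp [forall_and]
    simp only [this, ite_and]
    split_ifs <;> simp
  simp only [hsq]
  rw [prodExpect_sum]
  have h : ∀ z : Fin u, prodExpect (fun (_ : Fin m) (_ : Fin u) => 1 / (u : ℝ))
      (fun x => ∑ t, if ∀ i, x i ∉ ({z, t} : Finset (Fin u)) then (1 : ℝ) else 0) ≤
      (1 - 1 / (u : ℝ)) ^ m + u * ((1 - 1 / u) ^ m) ^ 2 := by
    intro z
    rw [prodExpect_sum]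
    simp only [prodExpect_indicator_avoid hu]
    have hle : ∀ t : Fin u, (1 - (({z, t} : Finset (Fin u)).card : ℝ) / u) ^ m ≤
        (if t = z then (1 - 1 / (u : ℝ)) ^ m else 0) + ((1 - 1 / u) ^ m) ^ 2 := by
      intro t
      by_cases ht : t = z
      · subst ht
        simp
        positivity
      · rw [card_pair (Ne.symm ht), if_neg ht, zero_add, ← pow_mul, mul_comm m 2, pow_mul]
        -- Two distinct points force `u ≥ 2`, so that the base `1 - 2 / u` is nonnegative.
        have h2 : 2 ≤ u := by
          have := card_le_univ ({z, t} : Finset (Fin u))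
          rw [card_pair (Ne.symm ht)] at this
          simpa using this
        have h2' : (2 : ℝ) ≤ u := by exact_mod_cast h2
        refine pow_le_pow_left₀ ?_ ?_ m
        · rw [sub_nonneg, div_le_one hu']
          exact_mod_cast h2'
        · have : (1 - 1 / (u : ℝ)) ^ 2 = 1 - 2 / u + (1 / u) ^ 2 := by ring
          rw [this]
          push_cast
          nlinarith [sq_nonneg (1 / (u : ℝ))]
    refine (sum_le_sum fun t _ => hle t).trans ?_
    rw [sum_add_distrib]
    simp
  refine (sum_le_sum fun z _ => h z).trans ?_
  rw [sum_const, card_univ, Fintype.card_fin, nsmul_eq_mul]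
  apply le_of_eq
  ring

/-- The coupon collector's bound: if `μ` coupons are missed on average, then at least `μ / 2` are
missed with high probability. -/
theorem expect_few_missed_le {u m k : ℕ} (hu : 0 < u)
    (hk : 2 * (k : ℝ) ≤ u * (1 - 1 / u) ^ m) (hk8 : 8 ≤ k) :
    prodExpect (fun (_ : Fin m) (_ : Fin u) => 1 / (u : ℝ))
      (fun x => if (missed x).card < k then (1 : ℝ) else 0) ≤ 1 / 4 := by
  set μ := (u : ℝ) * (1 - 1 / u) ^ m with hμ
  have hk' : (8 : ℝ) ≤ k := by exact_mod_cast hk8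
  have hμ0 : 0 < μ := by linarith
  have hw1 : ∀ _ : Fin m, ∑ _z : Fin u, 1 / (u : ℝ) = 1 := fun _ => by
    have : (u : ℝ) ≠ 0 := by exact_mod_cast hu.ne'
    simp [this]
  -- Chebyshev's inequality: the variance is at most `μ`, and `4 / μ ≤ 1 / 4` because `μ ≥ 2 k ≥
  -- 16`.
  have hle : ∀ x : Fin m → Fin u, (if (missed x).card < k then (1 : ℝ) else 0) ≤
      4 / μ ^ 2 * (((missed x).card : ℝ) ^ 2 - 2 * μ * (missed x).card + μ ^ 2) := by
    intro x
    have e : ((missed x).card : ℝ) ^ 2 - 2 * μ * (missed x).card + μ ^ 2 =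
      (μ - (missed x).card) ^ 2 := by ring
    rw [e]
    split_ifs with h
    · have h1 : ((missed x).card : ℝ) ≤ k := by exact_mod_cast h.le
      have h2 : (μ / 2) ^ 2 ≤ (μ - (missed x).card) ^ 2 :=
        pow_le_pow_left₀ (by positivity) (by linarith) 2
      rw [div_mul_eq_mul_div, one_le_div (by positivity)]
      linarith
    · positivity
  refine (prodExpect_mono (fun _ _ => by positivity) hle).trans ?_
  rw [prodExpect_const_mul, prodExpect_add, prodExpect_sub, prodExpect_const_mul,
    prodExpect_const hw1, expect_card_missed hu, ← hμ]
  have h2 := expect_card_missed_sq_le (m := m) hu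
  rw [← hμ] at h2
  rw [div_mul_eq_mul_div, div_le_iff₀ (by positivity)]
  nlinarith

theorem sampleProb_eq_prodExpect {u m : ℕ} (D : Fin u → ℝ) (P : (Fin m → Fin u) → Prop)
    [DecidablePred P] :
    sampleProb D m P = prodExpect (fun _ => D) (fun x => if P x then (1 : ℝ) else 0) := by
  simp only [sampleProb, prodExpect]
  refine sum_congr rfl fun x _ => ?_
  by_cases h : P x <;> simp [h]

/-! ### Adjusting the VC-dimension. -/

/-- Remove a point `t` from a shattered set. Each trace `U` on the rest comes from two different
sets, one with and one without `t`, and at most one of them is the new set `s`. -/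
theorem vcDim_insert_le {α : Type*} [DecidableEq α] (𝒜 : Finset (Finset α)) (s : Finset α) :
    (insert s 𝒜).vcDim ≤ 𝒜.vcDim + 1 := by
  refine Finset.sup_le fun T hT => ?_
  rw [mem_shatterer] at hT
  rcases T.eq_empty_or_nonempty with rfl | ⟨t, ht⟩
  · simp
  have hsh : 𝒜.Shatters (T.erase t) := by
    intro U hU
    have htU : t ∉ U := fun h => (mem_erase.mp (hU h)).1 rfl
    have hUT : U ⊆ T := hU.trans (erase_subset _ _)
    obtain ⟨u₁, hu₁, e₁⟩ := hT hUT
    obtain ⟨u₂, hu₂, e₂⟩ := hT (insert_subset ht hUT)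
    have ht₁ : t ∉ u₁ := fun h => htU (e₁ ▸ mem_inter.mpr ⟨ht, h⟩)
    have ht₂ : t ∈ u₂ := (mem_inter.mp (e₂ ▸ mem_insert_self t U)).2
    have hne : u₁ ≠ u₂ := fun h => ht₁ (h ▸ ht₂)
    rcases mem_insert.mp hu₁ with h₁ | h₁
    · refine ⟨u₂, (mem_insert.mp hu₂).resolve_left fun h => hne (h₁.trans h.symm), ?_⟩
      rw [erase_inter, e₂, erase_insert htU]
    · refine ⟨u₁, h₁, ?_⟩
      rw [erase_inter, e₁, erase_eq_of_notMem htU]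
  have := hsh.card_le_vcDim
  rw [card_erase_of_mem ht] at this
  omega

theorem vcDim_le_of_card_le {α : Type*} [DecidableEq α] {𝒜 : Finset (Finset α)} {d : ℕ}
    (h : 𝒜.card ≤ 2 ^ d) : 𝒜.vcDim ≤ d := by
  refine Finset.sup_le fun T hT => ?_
  rw [mem_shatterer, shatters_iff] at hT
  have h1 : 2 ^ T.card ≤ 2 ^ d := by
    rw [← card_powerset, ← hT]
    exact card_image_le.trans h
  exact (Nat.pow_le_pow_iff_right one_lt_two).mp h1

theorem vcDimension_univ (u : ℕ) : vcDimension (univ : Finset (Hypothesis (Fin u))) = u := by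
  have h : (univ : Finset (Hypothesis (Fin u))).image (fun h => univ.filter fun x => h x = 1) =
      univ := by
    refine eq_univ_of_forall fun s => mem_image.mpr ⟨fun x => if x ∈ s then 1 else -1,
      mem_univ _, ?_⟩
    ext x
    by_cases hx : x ∈ s
    · simp [hx]
    · simp only [mem_filter, mem_univ, true_and, hx, if_false, iff_false]
      decide
  unfold vcDimension
  rw [h]
  apply le_antisymm
  · exact Finset.sup_le fun T _ => (card_le_univ T).trans (by simp)
  · have := (univ_shatters (α := Fin u) (s := univ)).card_le_vcDim
    simpa using this

/-- A small hypothesis set can be enlarged to one of any given VC-dimension. -/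
theorem exists_superset_vcDimension_eq {u d : ℕ} (hd : d ≤ u) (H₀ : Finset (Hypothesis (Fin u)))
    (h₀ : H₀.card ≤ 2 ^ d) : ∃ H, H₀ ⊆ H ∧ vcDimension H = d := by
  classical
  have hne : (univ.filter fun H : Finset (Hypothesis (Fin u)) =>
      H₀ ⊆ H ∧ vcDimension H ≤ d).Nonempty :=
    ⟨H₀, mem_filter.mpr ⟨mem_univ _, Subset.rfl, vcDim_le_of_card_le (card_image_le.trans h₀)⟩⟩
  -- A largest family of VC-dimension at most `d` attains `d`: one more hypothesis raises the
  -- dimension by at most one, and the full family has dimension `u ≥ d`.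
  obtain ⟨H, hH, hmax⟩ := exists_max_image _ card hne
  obtain ⟨-, hsub, hle⟩ := mem_filter.mp hH
  refine ⟨H, hsub, hle.antisymm ?_⟩
  by_contra! hlt
  have hHu : H ≠ univ := by
    rintro rfl
    rw [vcDimension_univ] at hlt
    omega
  obtain ⟨h, hh⟩ : ∃ h, h ∉ H := by
    by_contra! hc
    exact hHu (eq_univ_of_forall hc)
  have hle' : vcDimension (insert h H) ≤ d := by
    have := vcDim_insert_le (H.image fun h => univ.filter fun x => h x = 1)
      (univ.filter fun x => h x = 1)
    unfold vcDimension at hlt ⊢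
    rw [image_insert]
    omega
  have := hmax (insert h H) (mem_filter.mpr ⟨mem_univ _, hsub.trans (subset_insert _ _), hle'⟩)
  rw [card_insert_of_notMem hh] at this
  omega

/-! ### The matrix, the weak learner and the error of AdaBoost. -/

theorem predictionError_one {u : ℕ} (Q : Fin u → ℝ) (h : Hypothesis (Fin u)) :
    predictionError Q (fun _ => 1) h = ∑ x, Q x * ((1 - labelVal (h x)) / 2) := by
  unfold predictionError
  refine sum_congr rfl fun x _ => ?_
  rcases Int.units_eq_one_or (h x) with hx | hx
  · simp [hx]
  · rw [hx, if_pos (show (-1 : ℤˣ) ≠ 1 by decide), labelVal_neg_one]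
    norm_num

/-- The average error of the `L` rows under `Q` is at most `1 / 2 - β / 4`, because their average
vote is at least `β / 2` at each point outside `M`. -/
theorem exists_predictionError_le {u L : ℕ} (hL : 0 < L) {β : ℝ} {M : Finset (Fin u)}
    {Y : Fin L → Hypothesis (Fin u)} (hY : ∀ x ∉ M, β / 2 * L ≤ ∑ l, labelVal (Y l x))
    {Q : Fin u → ℝ} (hQ : Q ∈ stdSimplex ℝ (Fin u)) (hQM : ∀ x ∈ M, Q x = 0) :
    ∃ l, predictionError Q (fun _ => 1) (Y l) ≤ 1 / 2 - β / 4 := by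
  by_contra! hc
  have h1 : ∑ _l : Fin L, (1 / 2 - β / 4) < ∑ l, predictionError Q (fun _ => 1) (Y l) :=
    sum_lt_sum (fun l _ => (hc l).le) ⟨⟨0, hL⟩, mem_univ _, hc _⟩
  have h2 : ∑ l, predictionError Q (fun _ => 1) (Y l) ≤ ∑ x, Q x * (L * (1 / 2 - β / 4)) := by
    simp only [predictionError_one]
    rw [sum_comm]
    refine sum_le_sum fun x _ => ?_
    by_cases hx : x ∈ M
    · simp [hQM x hx]
    · rw [← mul_sum]
      refine mul_le_mul_of_nonneg_left ?_ (hQ.1 x)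
      have := hY x hx
      rw [← sum_div, sum_sub_distrib]
      simp only [sum_const, card_univ, Fintype.card_fin, nsmul_eq_mul, mul_one]
      linarith
  rw [← sum_mul, hQ.2, one_mul] at h2
  simp only [sum_const, card_univ, Fintype.card_fin, nsmul_eq_mul] at h1
  linarith

theorem exists_le_of_prodExpect_le {ι α : Type*} [Fintype ι] [DecidableEq ι] [Fintype α]
    {w : ι → α → ℝ} (hw0 : ∀ i a, 0 ≤ w i a) (hw1 : ∀ i, ∑ a, w i a = 1)
    {f : (ι → α) → ℝ} {c : ℝ} (h : prodExpect w f ≤ c) : ∃ y, f y ≤ c := by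
  by_contra! hc
  have h1 := prodExpect_const hw1 1
  simp only [prodExpect, mul_one] at h1
  obtain ⟨y, -, hy⟩ := exists_lt_of_sum_lt (s := univ) (f := fun _ : ι → α => (0 : ℝ))
    (g := fun y => ∏ i, w i (y i)) (by rw [h1]; simp)
  have h2 : prodExpect w (fun _ => c) < prodExpect w f :=
    sum_lt_sum (fun z _ => mul_le_mul_of_nonneg_left (hc z).le (prod_nonneg fun i _ => hw0 i _))
      ⟨y, mem_univ _, mul_lt_mul_of_pos_left (hc y) hy⟩
  rw [prodExpect_const hw1] at h2
  linarith

open Classical in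
/-- There is a matrix for which a random sample avoids a good set with constant probability. -/
theorem exists_matrix {u L R N k m : ℕ} {β ζ : ℝ} (hβ0 : 0 ≤ β) (hβ1 : β ≤ 1) (hu : 0 < u)
    (hk8 : 8 ≤ k) (hmiss : 2 * (k : ℝ) ≤ u * (1 - 1 / u) ^ m)
    (hgood : ∀ M : Finset (Fin u), M.card = k →
      matrixExpect β (fun A : Fin L → Fin R → Fin u → ℤˣ =>
        if IsGood β ζ N M A then (0 : ℝ) else 1) ≤ 1 / 4) :
    ∃ A : Fin L → Fin R → Fin u → ℤˣ, 1 / 2 ≤ sampleProb (fun _ : Fin u => 1 / (u : ℝ)) m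
      (fun x => ∃ M, (M.card = k ∧ IsGood β ζ N M A) ∧ ∀ i, x i ∉ M) := by
  set ν : (Fin m → Fin u) → ℝ := fun x => ∏ _i : Fin m, 1 / (u : ℝ) with hν
  have hν0 : ∀ x, 0 ≤ ν x := fun x => prod_nonneg fun _ _ => by positivity
  have hw1 : ∀ _ : Fin m, ∑ _z : Fin u, 1 / (u : ℝ) = 1 := fun _ => by
    have : (u : ℝ) ≠ 0 := by exact_mod_cast hu.ne'
    simp [this]
  set P : (Fin L → Fin R → Fin u → ℤˣ) → (Fin m → Fin u) → Prop := fun A x =>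
    ∃ M, (M.card = k ∧ IsGood β ζ N M A) ∧ ∀ i, x i ∉ M with hP
  have hw0 : ∀ (_ : Fin L) (g : Fin R → Fin u → ℤˣ), 0 ≤ ∏ r, rowWeight β (g r) :=
    fun _ g => prod_nonneg fun r _ => rowWeight_nonneg hβ0 hβ1 _
  have hwL : ∀ _ : Fin L, ∑ g : Fin R → Fin u → ℤˣ, ∏ r, rowWeight β (g r) = 1 := fun _ => by
    have := prodExpect_const (w := fun _ : Fin R => rowWeight (u := u) β)
      (fun _ => rowWeight_sum u β) 1
    simpa [prodExpect] using this
  have havg : matrixExpect β (fun A : Fin L → Fin R → Fin u → ℤˣ =>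
      ∑ x, ν x * (1 - if P A x then (1 : ℝ) else 0)) ≤ 1 / 2 := by
    have hx : ∀ x, matrixExpect β (fun A : Fin L → Fin R → Fin u → ℤˣ =>
        1 - if P A x then (1 : ℝ) else 0) ≤
        (if (missed x).card < k then (1 : ℝ) else 0) + 1 / 4 := by
      intro x
      split_ifs with hx
      · have : matrixExpect β (fun A : Fin L → Fin R → Fin u → ℤˣ =>
          1 - if P A x then (1 : ℝ) else 0) ≤ prodExpect (fun _ g => ∏ r, rowWeight β (g r))
            (fun _ : Fin L → Fin R → Fin u → ℤˣ => 1) :=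
          prodExpect_mono hw0 fun A => by split_ifs <;> norm_num
        rw [prodExpect_const hwL] at this
        linarith
      -- `M` depends on the sample only, so for this sample the bound for a random matrix applies to
      -- it.
      · obtain ⟨M, hM, hMk⟩ := exists_subset_card_eq (not_lt.mp hx)
        rw [zero_add]
        refine le_trans (prodExpect_mono hw0 fun A => ?_) (hgood M hMk)
        by_cases hA : IsGood β ζ N M A
        · have : P A x := ⟨M, ⟨hMk, hA⟩, fun i hi => (mem_filter.mp (hM hi)).2 i rfl⟩
          simp [this, hA]
        · rw [if_neg hA]
          split_ifs <;> norm_num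
    have hmain := expect_few_missed_le hu hmiss hk8
    unfold matrixExpect
    rw [prodExpect_sum]
    calc _ = ∑ x, ν x * matrixExpect β (fun A : Fin L → Fin R → Fin u → ℤˣ =>
          1 - if P A x then (1 : ℝ) else 0) :=
          sum_congr rfl fun x _ => prodExpect_const_mul _ _
      _ ≤ ∑ x, ν x * ((if (missed x).card < k then (1 : ℝ) else 0) + 1 / 4) :=
          sum_le_sum fun x _ => mul_le_mul_of_nonneg_left (hx x) (hν0 x)
      _ = prodExpect (fun (_ : Fin m) (_ : Fin u) => 1 / (u : ℝ))
            (fun x => (if (missed x).card < k then (1 : ℝ) else 0) + 1 / 4) := rfl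
      _ ≤ _ := by
          rw [prodExpect_add, prodExpect_const hw1]
          linarith
  obtain ⟨A, hA⟩ := exists_le_of_prodExpect_le hw0 hwL havg
  refine ⟨A, ?_⟩
  rw [sampleProb_eq_prodExpect]
  have h1 : prodExpect (fun (_ : Fin m) (_ : Fin u) => 1 / (u : ℝ))
      (fun x => 1 - if P A x then (1 : ℝ) else 0) ≤ 1 / 2 := hA
  rw [prodExpect_sub, prodExpect_const hw1] at h1
  change 1 / 2 ≤ prodExpect (fun (_ : Fin m) (_ : Fin u) => 1 / (u : ℝ))
    (fun x => if P A x then (1 : ℝ) else 0)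
  linarith

open Classical in
/-- The weak learner that uses the rows chosen for a good set of mass zero, if there is one. -/
def hardLearner {u L R : ℕ} (β ζ : ℝ) (N k : ℕ) (A : Fin L → Fin R → Fin u → ℤˣ)
    (Q : Fin u → ℝ) : Hypothesis (Fin u) :=
  if h : ∃ M : Finset (Fin u), (M.card = k ∧ IsGood β ζ N M A) ∧
      M ⊆ univ.filter fun x => Q x = 0 then
    if h2 : ∃ l, predictionError Q (fun _ => 1) (badRow β ζ h.choose A l) ≤ 1 / 2 - β / 4 then
      badRow β ζ h.choose A h2.choose
    else fun _ => 1
  else fun _ => 1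

open Classical in
/-- The hypotheses that `hardLearner` uses. -/
def rowHypotheses {u L R : ℕ} (A : Fin L → Fin R → Fin u → ℤˣ) : Finset (Hypothesis (Fin u)) :=
  insert (fun _ => 1) (univ.image fun i : Fin L × Fin R => A i.1 i.2)

theorem card_rowHypotheses_le {u L R : ℕ} (A : Fin L → Fin R → Fin u → ℤˣ) :
    (rowHypotheses A).card ≤ L * R + 1 := by
  classical
  refine (card_insert_le _ _).trans (Nat.succ_le_succ (card_image_le.trans ?_))
  simp

theorem badRow_mem_rowHypotheses {u L R : ℕ} (β ζ : ℝ) (M : Finset (Fin u))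
    (A : Fin L → Fin R → Fin u → ℤˣ) (l : Fin L) : badRow β ζ M A l ∈ rowHypotheses A := by
  classical
  rcases firstSat_mem (IsBad β ζ M) (fun _ => 1) (A l) with h | ⟨r, hr⟩
  · have : badRow β ζ M A l = fun _ => 1 := h
    rw [this]
    exact mem_insert_self _ _
  · have : badRow β ζ M A l = A l r := hr
    rw [this]
    exact mem_insert_of_mem (mem_image.mpr ⟨(l, r), mem_univ _, rfl⟩)

/-- The fallback is the target concept itself, so the guarantee holds for every distribution,
including those that vanish on no good set. -/
theorem isWeakLearner_hardLearner {u L R N k : ℕ} {β ζ : ℝ} (hβ : β ≤ 2)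
    (A : Fin L → Fin R → Fin u → ℤˣ) {H : Finset (Hypothesis (Fin u))} (hH : rowHypotheses A ⊆ H) :
    IsWeakLearner (β / 4) (fun _ => 1) H (hardLearner β ζ N k A) := by
  classical
  intro Q _
  have h1 : (fun _ => 1 : Hypothesis (Fin u)) ∈ H ∧
      predictionError Q (fun _ => 1) (fun _ => 1) ≤ 1 / 2 - β / 4 := by
    refine ⟨hH (mem_insert_self _ _), ?_⟩
    simp only [predictionError, ne_eq, not_true_eq_false, if_false, sum_const_zero]
    linarith
  unfold hardLearner
  split_ifs with h h2
  · exact ⟨hH (badRow_mem_rowHypotheses _ _ _ _ _), h2.choose_spec⟩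
  · exact h1
  · exact h1

/-- AdaBoost with `hardLearner` has a large error if the sample avoids a good set. -/
theorem lt_predictionError_adaBoost {u L R N k m T : ℕ} {β ζ ε : ℝ} (hβ : 0 < β)
    (hL : 0 < L) (hN : 64 ≤ N * β ^ 2) (hu : 0 < u) (hε : ε * u < k / 64)
    (A : Fin L → Fin R → Fin u → ℤˣ) (hm : 0 < m) (hT : 1 ≤ T) (x : Fin m → Fin u)
    (hx : ∃ M, (M.card = k ∧ IsGood β ζ N M A) ∧ ∀ i, x i ∉ M) :
    ε < predictionError (fun _ : Fin u => 1 / (u : ℝ)) (fun _ => 1)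
      (adaBoost (hardLearner β ζ N k A) (labelled (fun _ => 1) x) T) := by
  classical
  set Z : Finset (Fin u) := univ.filter fun z => ∀ i, x i ≠ z with hZ
  have hex : ∃ M : Finset (Fin u), (M.card = k ∧ IsGood β ζ N M A) ∧ M ⊆ Z := by
    obtain ⟨M, hM, hxM⟩ := hx
    exact ⟨M, hM, fun z hz => mem_filter.mpr ⟨mem_univ _, fun i hi => hxM i (hi ▸ hz)⟩⟩
  obtain ⟨⟨hMk, hMg⟩, hMZ⟩ := hex.choose_spec
  set M := hex.choose with hMdef
  set Y := badRow β ζ M A with hY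
  have hW : ∀ p : Fin m → ℝ, (∀ i, 0 < p i) → ∑ i, p i = 1 →
      (∃ l, hardLearner β ζ N k A (inducedDist (labelled (fun _ => 1) x) p) = Y l) ∧
      predictionError (inducedDist (labelled (fun _ => 1) x) p) (fun _ => 1)
        (hardLearner β ζ N k A (inducedDist (labelled (fun _ => 1) x) p)) ≤ 1 / 2 - β / 4 := by
    intro p hp hp1
    set Q := inducedDist (labelled (fun _ => 1) x) p with hQ
    -- As all sample weights are positive, the zero set of `Q` is the set of missed points. The
    -- choice of `M` in `hardLearner` depends only on this set, hence is the same in all rounds.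
    have hZQ : (univ.filter fun z => Q z = 0) = Z := by
      ext z
      simp only [hQ, hZ, mem_filter, mem_univ, true_and]
      exact inducedDist_eq_zero_iff _ hp z
    have h2 : ∃ l, predictionError Q (fun _ => 1) (Y l) ≤ 1 / 2 - β / 4 := by
      refine exists_predictionError_le hL hMg.margin
        (inducedDist_mem_stdSimplex _ (fun i => (hp i).le) hp1) fun z hz => ?_
      have := hMZ hz
      rw [← hZQ] at this
      exact (mem_filter.mp this).2
    have hval : ∃ h2 : ∃ l, predictionError Q (fun _ => 1) (Y l) ≤ 1 / 2 - β / 4,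
        hardLearner β ζ N k A Q = Y h2.choose := by
      refine ⟨h2, ?_⟩
      unfold hardLearner
      simp only [hZQ]
      rw [dif_pos hex, dif_pos h2]
    obtain ⟨h3, hval⟩ := hval
    rw [hval]
    exact ⟨⟨_, rfl⟩, h3.choose_spec⟩
  have hm0 : (0 : ℝ) < m := by exact_mod_cast hm
  obtain ⟨b, hb0, hb1, hb⟩ := exists_adaBoostFrom_vote x hm Y (by positivity : 0 < β / 4) hW T
    (fun _ => 1 / (m : ℝ)) (fun _ => by positivity) (by simp [hm0.ne']) (fun _ => 0)
    (fun _ => le_rfl) (Or.inl hT)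
  simp only [zero_mul, sum_const_zero] at hb
  have hcard := card_neg_ge hβ hN M Y hMg.negVotes b hb0 hb1
  rw [hMk] at hcard
  have hu' : (0 : ℝ) < u := by exact_mod_cast hu
  have hsub : ((M.filter fun z => ∑ l, b l * labelVal (Y l z) < 0).card : ℝ) * (1 / u) ≤
      predictionError (fun _ : Fin u => 1 / (u : ℝ)) (fun _ => 1)
        (adaBoost (hardLearner β ζ N k A) (labelled (fun _ => 1) x) T) := by
    rw [← nsmul_eq_mul, ← sum_const, predictionError, ← sum_filter]
    refine sum_le_sum_of_subset_of_nonneg (fun z hz => ?_) fun _ _ _ => by positivity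
    exact mem_filter.mpr ⟨mem_univ _, hb z (mem_filter.mp hz).2⟩
  refine lt_of_lt_of_le ?_ hsub
  rw [mul_one_div, lt_div_iff₀ hu']
  linarith

/-! ### Numerical estimates; the three failure probabilities are at most `1 / 12` each. -/

theorem exp_neg_three_le : Real.exp (-3) ≤ 1 / 12 := by
  have h := Real.exp_one_gt_d9
  have h3 : Real.exp 3 = Real.exp 1 ^ 3 := by
    rw [← Real.exp_nat_mul]
    norm_num
  have h4 : (2.7 : ℝ) ^ 3 ≤ Real.exp 1 ^ 3 := pow_le_pow_left₀ (by norm_num) (by linarith) 3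
  rw [Real.exp_neg, h3, inv_le_comm₀ (by positivity) (by norm_num)]
  refine le_trans ?_ h4
  norm_num

/-- Some group has no bad row: `q R` is at least `exp (9 d / 20) / 2`, so `R` trials fail with
negligible probability. -/
theorem mul_one_sub_pow_le {d q : ℝ} (hd : 10 ^ 16 ≤ d) (hq : 1 / 2 * Real.exp (-(d / 20)) ≤ q)
    (hq1 : q ≤ 1) {L R : ℕ} (hL : (L : ℝ) ≤ 2 * Real.exp (d / (2 * 10 ^ 6)))
    (hR : Real.exp (d / 2) ≤ R) : L * (1 - q) ^ R ≤ 1 / 12 := by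
  have h1 : (1 - q) ^ R ≤ Real.exp (-(q * R)) := by
    have : 1 - q ≤ Real.exp (-q) := by
      have := Real.add_one_le_exp (-q)
      linarith
    calc (1 - q) ^ R ≤ Real.exp (-q) ^ R := pow_le_pow_left₀ (by linarith) this R
      _ = _ := by rw [← Real.exp_nat_mul]; congr 1; ring
  have h2 : d / 5 ≤ q * R := by
    have h3 : 1 / 2 * Real.exp (-(d / 20)) * Real.exp (d / 2) ≤ q * R :=
      mul_le_mul hq hR (Real.exp_pos _).le ((by positivity : (0 : ℝ) ≤ _).trans hq)
    rw [mul_assoc, ← Real.exp_add] at h3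
    have h4 := Real.add_one_le_exp (-(d / 20) + d / 2)
    linarith
  have h5 : (1 - q) ^ R ≤ Real.exp (-(d / 5)) :=
    h1.trans (Real.exp_le_exp.mpr (by linarith))
  calc (L : ℝ) * (1 - q) ^ R ≤ 2 * Real.exp (d / (2 * 10 ^ 6)) * Real.exp (-(d / 5)) :=
        mul_le_mul hL h5 (pow_nonneg (by linarith) R) (by positivity)
    _ = 2 * Real.exp (d / (2 * 10 ^ 6) + -(d / 5)) := by rw [mul_assoc, ← Real.exp_add]
    _ ≤ 2 * Real.exp (-(d / 10)) := by
        have : d / (2 * 10 ^ 6) + -(d / 5) ≤ -(d / 10) := by norm_num; linarith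
        have := Real.exp_le_exp.mpr this
        linarith
    _ ≤ 1 / 12 := by
        have h6 := Real.add_one_le_exp (d / 10)
        rw [Real.exp_neg, ← div_eq_mul_inv, div_le_div_iff₀ (Real.exp_pos _) (by norm_num)]
        linarith

/-- Some margin outside `M` is small. With `X = exp (b d)` one has `1 / ε ≤ exp X`, hence `u ≤ exp
(d + 2 log (1 / γ) + X)`, whereas `γ² L ≥ X³`. -/
theorem mul_exp_neg_sq_mul_le {d γ ε : ℝ} (hd : 10 ^ 16 ≤ d) (hγ : 0 < γ)
    (hdγ : 10 ^ 16 * Real.log (1 / γ) ≤ d)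
    (hε : Real.exp (-Real.exp (1 / (8 * 10 ^ 6) * d)) ≤ ε) {u L : ℕ}
    (hu : (u : ℝ) ≤ d / γ ^ 2 / ε) (hL : Real.exp (d / (2 * 10 ^ 6)) ≤ L) :
    u * Real.exp (-(γ ^ 2 * L)) ≤ 1 / 12 := by
  set g := Real.log (1 / γ) with hg
  have hγe : γ = Real.exp (-g) := by
    rw [hg, one_div, Real.log_inv, neg_neg, Real.exp_log hγ]
  have hγ2 : γ ^ 2 = Real.exp (-(2 * g)) := by
    rw [hγe, ← Real.exp_nat_mul]
    congr 1
    push_cast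
    ring
  set X := Real.exp (1 / (8 * 10 ^ 6) * d) with hX
  have hε0 : 0 < ε := (Real.exp_pos _).trans_le hε
  have hXd : 1 / (8 * 10 ^ 6) * d + 1 ≤ X := Real.add_one_le_exp _
  have hX1 : 1 ≤ X := by
    have : 0 ≤ 1 / (8 * 10 ^ 6) * d := by positivity
    linarith
  -- Here `3 b = 3 / (8 * 10 ^ 6)` is less than the rate `1 / (2 * 10 ^ 6)` of `L`; the difference
  -- pays for `γ²`.
  have hX3 : X ^ 3 ≤ γ ^ 2 * L := by
    calc X ^ 3 = Real.exp (3 * (1 / (8 * 10 ^ 6) * d)) := by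
          rw [hX, ← Real.exp_nat_mul]; norm_num
      _ ≤ Real.exp (-(2 * g) + d / (2 * 10 ^ 6)) := by
          apply Real.exp_le_exp.mpr
          norm_num at hdγ ⊢
          linarith
      _ = γ ^ 2 * Real.exp (d / (2 * 10 ^ 6)) := by rw [Real.exp_add, hγ2]
      _ ≤ _ := mul_le_mul_of_nonneg_left hL (sq_nonneg γ)
  have hX2 : 100 * d ≤ X ^ 2 := by
    have h1 : (1 / (8 * 10 ^ 6) * d) ^ 2 ≤ X ^ 2 :=
      pow_le_pow_left₀ (by positivity) (by linarith) 2
    have h2 : 100 * d ≤ (1 / (8 * 10 ^ 6) * d) ^ 2 := by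
      norm_num at hd ⊢
      nlinarith
    linarith
  have hmain : d + 2 * g + X + 3 ≤ X ^ 3 := by
    have h1 : X * (100 * d) ≤ X * X ^ 2 := mul_le_mul_of_nonneg_left hX2 (by linarith)
    have h2 : 2 * g ≤ d := by norm_num at hdγ hd; linarith
    have h3 : 0 ≤ (X - 1) * (d - 1) := mul_nonneg (by linarith) (by norm_num at hd; linarith)
    have h4 : X ^ 3 = X * X ^ 2 := by ring
    have h5 : 0 ≤ (X - 1) * d := mul_nonneg (by linarith) (by linarith)
    norm_num at hd
    nlinarith
  have hu2 : (u : ℝ) ≤ Real.exp (d + 2 * g + X) := by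
    refine hu.trans ?_
    rw [Real.exp_add, Real.exp_add, div_div, div_le_iff₀ (by positivity), hγ2]
    have h1 : d ≤ Real.exp d := by
      have := Real.add_one_le_exp d
      linarith
    have h2 : 1 ≤ Real.exp X * ε := by
      have := mul_le_mul_of_nonneg_left hε (Real.exp_pos X).le
      rwa [← Real.exp_add, add_neg_cancel, Real.exp_zero] at this
    have h3 : Real.exp (2 * g) * Real.exp (-(2 * g)) = 1 := by
      rw [← Real.exp_add, add_neg_cancel, Real.exp_zero]
    calc d ≤ Real.exp d * (Real.exp X * ε) := by nlinarith [Real.exp_pos d]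
      _ = Real.exp d * (Real.exp (2 * g) * Real.exp (-(2 * g))) * (Real.exp X * ε) := by
          rw [h3, mul_one]
      _ = _ := by ring
  calc (u : ℝ) * Real.exp (-(γ ^ 2 * L)) ≤
        Real.exp (d + 2 * g + X) * Real.exp (-(γ ^ 2 * L)) :=
        mul_le_mul_of_nonneg_right hu2 (Real.exp_pos _).le
    _ = Real.exp (d + 2 * g + X + -(γ ^ 2 * L)) := (Real.exp_add _ _).symm
    _ ≤ Real.exp (-3) := Real.exp_le_exp.mpr (by linarith)
    _ ≤ 1 / 12 := exp_neg_three_le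

/-- Some `N`-tuple has few negative votes. The union bound and the change of measure cost `N` times
about `10 ^ (-6) d` in the exponent, against the gain `k / 32`, about `d / (3200 β²)`. -/
theorem pow_mul_pow_mul_exp_le {d β k : ℝ} (hd : 10 ^ 16 ≤ d) (hβ0 : 0 < β) (hβ1 : β ≤ 1 / 3)
    (hk1 : d / (100 * β ^ 2) - 1 ≤ k) (hk2 : β ^ 2 * k ≤ d / 100) {L N : ℕ}
    (hL : (L : ℝ) ≤ 2 * Real.exp (d / (2 * 10 ^ 6))) (hN : (N : ℝ) ≤ 64 / β ^ 2 + 1) :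
    (L : ℝ) ^ N * ((2 * Real.exp (2 * tilt β * (1 / 10 ^ 5) * β * k)) ^ N *
      Real.exp (-(k / 32))) ≤ 1 / 12 := by
  have h2e : (2 : ℝ) ≤ Real.exp 1 := by
    have := Real.add_one_le_exp 1
    linarith
  have hβ2 : β ^ 2 ≤ 1 := by nlinarith
  have hβ2' : 0 < β ^ 2 := by positivity
  have hk0 : 0 ≤ k := by
    have : 1 ≤ d / (100 * β ^ 2) := by
      rw [one_le_div (by positivity)]
      norm_num at hd
      linarith
    linarith
  have hL' : (L : ℝ) ≤ Real.exp (1 + d / (2 * 10 ^ 6)) := by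
    rw [Real.exp_add]
    exact hL.trans (mul_le_mul_of_nonneg_right h2e (Real.exp_pos _).le)
  have hK : 2 * Real.exp (2 * tilt β * (1 / 10 ^ 5) * β * k) ≤
      Real.exp (1 + 6 / 10 ^ 7 * d) := by
    rw [Real.exp_add]
    refine mul_le_mul h2e (Real.exp_le_exp.mpr ?_) (Real.exp_pos _).le (Real.exp_pos _).le
    have h1 : tilt β * (β * k) ≤ 3 * β * (β * k) :=
      mul_le_mul_of_nonneg_right (tilt_le hβ0.le hβ1) (by positivity)
    norm_num
    linarith
  have hN' : (N : ℝ) ≤ 65 / β ^ 2 := by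
    refine hN.trans ?_
    rw [div_add_one hβ2'.ne']
    exact div_le_div_of_nonneg_right (by linarith) hβ2'.le
  calc _ ≤ Real.exp (1 + d / (2 * 10 ^ 6)) ^ N * (Real.exp (1 + 6 / 10 ^ 7 * d) ^ N *
        Real.exp (-(k / 32))) := by
        gcongr
    _ = Real.exp (N * (2 + d / (2 * 10 ^ 6) + 6 / 10 ^ 7 * d) + -(k / 32)) := by
        rw [← Real.exp_nat_mul, ← Real.exp_nat_mul, ← Real.exp_add, ← Real.exp_add]
        congr 1
        ring
    _ ≤ Real.exp (-3) := by
        apply Real.exp_le_exp.mpr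
        have h1 : (N : ℝ) * (2 + d / (2 * 10 ^ 6) + 6 / 10 ^ 7 * d) ≤
            65 / β ^ 2 * (2 + d / (2 * 10 ^ 6) + 6 / 10 ^ 7 * d) :=
          mul_le_mul_of_nonneg_right hN' (by positivity)
        have h2 : 65 / β ^ 2 * (2 + d / (2 * 10 ^ 6) + 6 / 10 ^ 7 * d) ≤
            (d / (100 * β ^ 2) - 1) / 32 - 3 := by
          have e1 : 65 / β ^ 2 * (2 + d / (2 * 10 ^ 6) + 6 / 10 ^ 7 * d) =
              65 * (2 + d / (2 * 10 ^ 6) + 6 / 10 ^ 7 * d) / β ^ 2 := by ring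
          have e2 : (d / (100 * β ^ 2) - 1) / 32 - 3 = (d / 3200 - 97 / 32 * β ^ 2) / β ^ 2 := by
            field_simp
            ring
          rw [e1, e2]
          refine div_le_div_of_nonneg_right ?_ hβ2'.le
          norm_num at hd ⊢
          linarith
        linarith
    _ ≤ 1 / 12 := exp_neg_three_le

theorem exp_neg_two_mul_le {x : ℝ} (h0 : 0 ≤ x) (h1 : x ≤ 1 / 2) :
    Real.exp (-(2 * x)) ≤ 1 - x := by
  have h := Real.add_one_le_exp (2 * x)
  rw [Real.exp_neg, inv_le_comm₀ (Real.exp_pos _) (by linarith)]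
  refine le_trans ?_ h
  rw [inv_le_iff_one_le_mul₀ (by linarith)]
  nlinarith

/-- The expected number of missed points for samples of size below `κ u log (1 / ε)`. -/
theorem two_mul_le_expected_missed {ε k : ℝ} (hε0 : 0 < ε) (hε1 : ε ≤ 1 / 10 ^ 6) {u m : ℕ}
    (hu2 : 2 ≤ u) (hu : k / (256 * ε) ≤ u) (hk : 0 ≤ k)
    (hm : (m : ℝ) ≤ u * (Real.log (1 / ε) / 4)) :
    2 * k ≤ u * (1 - 1 / u) ^ m := by
  have hu2' : (2 : ℝ) ≤ u := by exact_mod_cast hu2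
  have hu0 : (0 : ℝ) < u := by linarith
  have h1 : Real.exp (-(2 * (1 / (u : ℝ)))) ≤ 1 - 1 / u := by
    refine exp_neg_two_mul_le (by positivity) ?_
    rw [div_le_div_iff₀ hu0 (by norm_num)]
    linarith
  have h2 : Real.exp (-(Real.log (1 / ε) / 2)) ≤ (1 - 1 / (u : ℝ)) ^ m := by
    refine le_trans ?_ (pow_le_pow_left₀ (Real.exp_pos _).le h1 m)
    rw [← Real.exp_nat_mul]
    apply Real.exp_le_exp.mpr
    have : (m : ℝ) * (1 / u) ≤ Real.log (1 / ε) / 4 := by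
      rw [mul_one_div, div_le_iff₀ hu0]
      linarith
    linarith
  -- `s` is the square root of `ε`; the claim reduces to `s ≤ 1 / 512`.
  set s := Real.exp (-(Real.log (1 / ε) / 2)) with hs
  have hs0 : 0 < s := Real.exp_pos _
  have hs2 : s * s = ε := by
    rw [hs, ← Real.exp_add, one_div, Real.log_inv]
    rw [show -(-Real.log ε / 2) + -(-Real.log ε / 2) = Real.log ε by ring, Real.exp_log hε0]
  have hs1 : s ≤ 1 / 512 := by
    by_contra! hc
    norm_num at hε1
    nlinarith
  calc 2 * k ≤ k / (256 * ε) * s := by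
        rw [← hs2, div_mul_eq_mul_div, le_div_iff₀ (by positivity)]
        have : 0 ≤ k * s * (1 / 512 - s) := mul_nonneg (by positivity) (by linarith)
        linarith
    _ ≤ u * (1 - 1 / u) ^ m := mul_le_mul hu h2 hs0.le hu0.le

theorem exists_nat_between_exp {x : ℝ} (hx : 0 ≤ x) :
    ∃ n : ℕ, Real.exp x ≤ n ∧ (n : ℝ) ≤ 2 * Real.exp x := by
  refine ⟨⌈Real.exp x⌉₊, Nat.le_ceil _, ?_⟩
  have h1 := Nat.ceil_lt_add_one (Real.exp_pos x).le
  have h2 := Real.one_le_exp hx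
  linarith

theorem mul_add_one_le_two_pow {d L R : ℕ} (hd16 : (10 : ℝ) ^ 16 ≤ d)
    (hL2 : (L : ℝ) ≤ 2 * Real.exp ((d : ℝ) / (2 * 10 ^ 6)))
    (hR2 : (R : ℝ) ≤ 2 * Real.exp ((d : ℝ) / 2)) : L * R + 1 ≤ 2 ^ d := by
  have hd16' : (10000000000000000 : ℝ) ≤ d := by norm_num at hd16 ⊢; exact_mod_cast hd16
  have hd0 : (0 : ℝ) < d := by linarith
  have h1 : (L : ℝ) * R ≤ 2 * Real.exp ((d : ℝ) / (2 * 10 ^ 6)) * (2 * Real.exp ((d : ℝ) / 2)) :=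
    mul_le_mul hL2 hR2 (Nat.cast_nonneg _) (by positivity)
  have h2 : (L : ℝ) * R + 1 ≤ 5 * Real.exp ((d : ℝ) / (2 * 10 ^ 6) + d / 2) := by
    rw [Real.exp_add]
    have h3 : 1 ≤ Real.exp ((d : ℝ) / (2 * 10 ^ 6)) * Real.exp ((d : ℝ) / 2) := by
      rw [← Real.exp_add]
      exact Real.one_le_exp (by positivity)
    linarith
  have h4 : (5 : ℝ) ≤ Real.exp 4 := by
    have := Real.add_one_le_exp 4
    linarith
  have h5 : (L : ℝ) * R + 1 ≤ 2 ^ d := by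
    calc _ ≤ 5 * Real.exp ((d : ℝ) / (2 * 10 ^ 6) + d / 2) := h2
      _ ≤ Real.exp 4 * Real.exp ((d : ℝ) / (2 * 10 ^ 6) + d / 2) :=
          mul_le_mul_of_nonneg_right h4 (Real.exp_pos _).le
      _ = Real.exp (4 + (d / (2 * 10 ^ 6) + d / 2)) := (Real.exp_add _ _).symm
      _ ≤ Real.exp (d * Real.log 2) := by
          apply Real.exp_le_exp.mpr
          have := mul_le_mul_of_nonneg_left Real.log_two_gt_d9.le hd0.le
          norm_num at this ⊢
          linarith
      _ = 2 ^ d := by rw [Real.exp_nat_mul, Real.exp_log two_pos]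
  exact_mod_cast h5

open Classical in
/-- A set of size about `d / (100 β ^ 2)` is good with probability at least `3 / 4`. -/
theorem matrixExpect_not_isGood_le_quarter {d u k L R N : ℕ} {γ β ε : ℝ}
    (hd16 : (10 : ℝ) ^ 16 ≤ d) (hγ0 : 0 < γ) (hd : 10 ^ 16 * Real.log (1 / γ) ≤ d)
    (hε : Real.exp (-Real.exp (1 / (8 * 10 ^ 6) * (d : ℝ))) ≤ ε) (hβ : β = 4 * γ)
    (hβ1 : β ≤ 1 / 3) {M : Finset (Fin u)} (hM : M.card = k)
    (hζ8 : 8 ≤ (1 / 10 ^ 5 : ℝ) ^ 2 * (β ^ 2 * M.card))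
    (hk1 : (d : ℝ) / (100 * β ^ 2) - 1 ≤ k) (hk2 : (k : ℝ) ≤ d / (100 * β ^ 2))
    (hu1 : (u : ℝ) ≤ k / (128 * ε)) (hL1 : Real.exp ((d : ℝ) / (2 * 10 ^ 6)) ≤ L)
    (hL2 : (L : ℝ) ≤ 2 * Real.exp ((d : ℝ) / (2 * 10 ^ 6))) (hR1 : Real.exp ((d : ℝ) / 2) ≤ R)
    (hN2 : (N : ℝ) ≤ 64 / β ^ 2 + 1) :
    matrixExpect β (fun A : Fin L → Fin R → Fin u → ℤˣ =>
      if IsGood β (1 / 10 ^ 5) N M A then (0 : ℝ) else 1) ≤ 1 / 4 := by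
  have hβ0 : 0 < β := by linarith
  have hd0 : (0 : ℝ) < d := lt_of_lt_of_le (by norm_num) hd16
  have hε0 : 0 < ε := (Real.exp_pos _).trans_le hε
  have hβγ : β ^ 2 = 16 * γ ^ 2 := by rw [hβ]; ring
  have hβk2 : β ^ 2 * k ≤ d / 100 := by
    rw [le_div_iff₀ (by positivity)] at hk2
    linarith
  refine (matrixExpect_not_isGood_le hβ0.le hβ1 (by norm_num) (by norm_num)
    hζ8).trans ?_
  have hqlow := badProb_ge (ζ := 1 / 10 ^ 5) hβ0.le (by linarith) (by norm_num) (by norm_num)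
    M hζ8
  have hq1 : badProb β (1 / 10 ^ 5) M ≤ 1 :=
    sum_ite_le_one (rowWeight_nonneg hβ0.le (by linarith)) (rowWeight_sum u β)
  rw [hM] at hqlow ⊢
  have hq : 1 / 2 * Real.exp (-((d : ℝ) / 20)) ≤ badProb β (1 / 10 ^ 5) M := by
    refine le_trans ?_ hqlow
    refine mul_le_mul_of_nonneg_left (Real.exp_le_exp.mpr (neg_le_neg ?_)) (by norm_num)
    have h1 : tilt β * ((1 + 1 / 10 ^ 5) * β * k) ≤ 3 * β * ((1 + 1 / 10 ^ 5) * β * k) :=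
      mul_le_mul_of_nonneg_right (tilt_le hβ0.le hβ1) (by positivity)
    norm_num at h1 ⊢
    linarith
  have t1 := mul_one_sub_pow_le hd16 hq hq1 hL2 hR1
  have hu4 : (u : ℝ) ≤ d / γ ^ 2 / ε := by
    refine hu1.trans ?_
    rw [div_le_div_iff₀ (by positivity) hε0]
    have h1 : (k : ℝ) ≤ d / γ ^ 2 := by
      refine hk2.trans ?_
      rw [hβγ]
      exact div_le_div_of_nonneg_left hd0.le (by positivity) (by nlinarith)
    have h2 : 0 ≤ (d : ℝ) / γ ^ 2 := by positivity
    nlinarith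
  have t2 := mul_exp_neg_sq_mul_le hd16 hγ0 hd hε hu4 hL1
  have t3 := pow_mul_pow_mul_exp_le hd16 hβ0 hβ1 hk1 hβk2 hL2 hN2
  rw [show β ^ 2 / 16 = γ ^ 2 by rw [hβγ]; ring]
  linarith

end

/-! ### The theorem: choice of the parameters. -/

theorem theorem1 :
    ∃ C > (0 : ℝ), ∃ a > (0 : ℝ), ∃ b > (0 : ℝ), ∃ κ > (0 : ℝ), ∃ δ > (0 : ℝ),
      ∀ γ : ℝ, 0 < γ → γ < C →
      ∀ d : ℕ, a * Real.log (1 / γ) ≤ (d : ℝ) →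
      ∀ ε : ℝ, Real.exp (-Real.exp (b * (d : ℝ))) ≤ ε → ε ≤ C →
      ∃ (u : ℕ) (H : Finset (Hypothesis (Fin u))) (W : (Fin u → ℝ) → Hypothesis (Fin u)),
        ∃ D ∈ stdSimplex ℝ (Fin u),
          vcDimension H = d ∧
          IsWeakLearner γ (fun _ => 1) H W ∧
          ∀ m T : ℕ, 1 ≤ m → 1 ≤ T →
            (m : ℝ) < κ * ((d : ℝ) * Real.log (1 / ε) / (γ ^ 2 * ε)) →
            δ ≤ sampleProb D m (fun x =>
              ε < predictionError D (fun _ => 1)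
                (adaBoost W (labelled (fun _ => 1) x) T)) := by
  classical
  -- The constants are `C`, `a`, `b`, `κ`, `δ`. The bound `γ < C` gives `log (1 / γ) ≥ 1`, hence `d
  -- ≥ a`; `δ = 1 / 2` is what two failure probabilities of `1 / 4` leave.
  refine ⟨1 / 10 ^ 6, by norm_num, 10 ^ 16, by norm_num, 1 / (8 * 10 ^ 6), by norm_num,
    1 / 10 ^ 7, by norm_num, 1 / 2, by norm_num, ?_⟩
  intro γ hγ0 hγC d hd ε hε hεC
  have hε0 : 0 < ε := (Real.exp_pos _).trans_le hε
  have hd16 : (10 : ℝ) ^ 16 ≤ d := by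
    have h1 : 1 ≤ Real.log (1 / γ) := by
      rw [Real.le_log_iff_exp_le (by positivity), le_div_iff₀ hγ0]
      have := Real.exp_one_lt_d9
      norm_num at hγC
      nlinarith
    linarith
  have hd16' : (10000000000000000 : ℝ) ≤ d := by norm_num at hd16 ⊢; exact_mod_cast hd16
  have hd0 : (0 : ℝ) < d := lt_of_lt_of_le (by norm_num) hd16
  obtain ⟨β, hβ⟩ : ∃ β, β = 4 * γ := ⟨_, rfl⟩
  have hβ0 : 0 < β := by linarith
  have hβ1 : β ≤ 1 / 3 := by norm_num at hγC; linarith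
  have hβγ : β ^ 2 = 16 * γ ^ 2 := by rw [hβ]; ring
  have hβsq : β ^ 2 ≤ 1 := by nlinarith
  -- the size of the sets of missed points
  obtain ⟨k, hk1, hk2⟩ : ∃ k : ℕ, (d : ℝ) / (100 * β ^ 2) - 1 ≤ k ∧
      (k : ℝ) ≤ d / (100 * β ^ 2) :=
    ⟨_, (Nat.sub_one_lt_floor _).le, Nat.floor_le (by positivity)⟩
  have hq200 : 1 ≤ (d : ℝ) / (200 * β ^ 2) := by
    rw [one_le_div (by positivity)]
    linarith
  have hhalf : (d : ℝ) / (100 * β ^ 2) = 2 * (d / (200 * β ^ 2)) := by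
    field_simp
    norm_num
  have hk3 : (d : ℝ) / (200 * β ^ 2) ≤ k := by linarith
  have hβk1 : (d : ℝ) / 200 ≤ β ^ 2 * k := by
    rw [div_le_iff₀ (by positivity)] at hk3
    linarith
  have hβk2 : β ^ 2 * k ≤ d / 100 := by
    rw [le_div_iff₀ (by positivity)] at hk2
    linarith
  have hkd : (d : ℝ) / 200 ≤ k := by
    have : β ^ 2 * k ≤ 1 * k := mul_le_mul_of_nonneg_right hβsq (Nat.cast_nonneg _)
    linarith
  have hk8 : 8 ≤ k := by
    have : (8 : ℝ) ≤ k := by linarith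
    exact_mod_cast this
  have hk0 : (0 : ℝ) < k := by
    have : (8 : ℝ) ≤ k := by exact_mod_cast hk8
    linarith
  -- the size of the universe
  obtain ⟨u, hu1, hu2⟩ : ∃ u : ℕ, (u : ℝ) ≤ k / (128 * ε) ∧ (k : ℝ) / (128 * ε) - 1 ≤ u :=
    ⟨_, Nat.floor_le (by positivity), (Nat.sub_one_lt_floor _).le⟩
  have hku : (k : ℝ) * 3000 ≤ k / (256 * ε) := by
    rw [le_div_iff₀ (by positivity)]
    have h1 : ε * (256 * 3000) ≤ 1 := by norm_num at hεC; linarith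
    have h2 := mul_le_mul_of_nonneg_left h1 hk0.le
    linarith
  have hu3 : (k : ℝ) / (256 * ε) ≤ u := by
    have h1 : (k : ℝ) / (128 * ε) = 2 * (k / (256 * ε)) := by
      field_simp
      norm_num
    have : (8 : ℝ) ≤ k := by exact_mod_cast hk8
    linarith
  have hdu : d ≤ u := by
    have : (d : ℝ) ≤ u := by linarith
    exact_mod_cast this
  have hu2' : 2 ≤ u := by
    have : (2 : ℝ) ≤ u := by linarith
    exact_mod_cast this
  have hu0 : 0 < u := by omega
  have hεu : ε * u < k / 64 := by
    rw [le_div_iff₀ (by positivity)] at hu1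
    linarith
  -- the number of groups, their size, and the size of the combinations
  obtain ⟨L, hL1, hL2⟩ := exists_nat_between_exp (x := (d : ℝ) / (2 * 10 ^ 6)) (by positivity)
  obtain ⟨R, hR1, hR2⟩ := exists_nat_between_exp (x := (d : ℝ) / 2) (by positivity)
  obtain ⟨N, hN1', hN2⟩ : ∃ N : ℕ, 64 / β ^ 2 ≤ N ∧ (N : ℝ) ≤ 64 / β ^ 2 + 1 :=
    ⟨_, Nat.le_ceil _, (Nat.ceil_lt_add_one (by positivity)).le⟩
  have hLpos : 0 < L := by exact_mod_cast (Real.exp_pos _).trans_le hL1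
  have hN1 : 64 ≤ N * β ^ 2 := by rwa [div_le_iff₀ (by positivity)] at hN1'
  have hLR := mul_add_one_le_two_pow hd16 hL2 hR2
  -- The width `ζ = 1 / 10 ^ 5` is small enough for the change of measure to be cheap; concentration
  -- in so narrow a window needs `d` to be as large as `10 ^ 16`.
  have hζ8 : ∀ M : Finset (Fin u), M.card = k →
      8 ≤ (1 / 10 ^ 5 : ℝ) ^ 2 * (β ^ 2 * M.card) := by
    intro M hM
    rw [hM]
    norm_num at hd16 ⊢
    linarith
  have hgood : ∀ M : Finset (Fin u), M.card = k →
      matrixExpect β (fun A : Fin L → Fin R → Fin u → ℤˣ =>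
        if IsGood β (1 / 10 ^ 5) N M A then (0 : ℝ) else 1) ≤ 1 / 4 := fun M hM =>
    matrixExpect_not_isGood_le_quarter hd16 hγ0 hd hε hβ hβ1 hM (hζ8 M hM) hk1 hk2 hu1 hL1 hL2
      hR1 hN2
  set B := 1 / 10 ^ 7 * ((d : ℝ) * Real.log (1 / ε) / (γ ^ 2 * ε)) with hB
  have hlog : 0 ≤ Real.log (1 / ε) := by
    apply Real.log_nonneg
    rw [one_le_div hε0]
    norm_num at hεC
    linarith
  have hB0 : 0 ≤ B := by positivity
  have hBu : B ≤ u * (Real.log (1 / ε) / 4) := by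
    refine le_trans ?_ (mul_le_mul_of_nonneg_right hu3 (by positivity))
    have h1 : (d : ℝ) / γ ^ 2 ≤ 3200 * k := by
      rw [hβγ] at hβk1
      rw [div_le_iff₀ (by positivity)]
      linarith
    have e1 : B = (d : ℝ) / γ ^ 2 * (Real.log (1 / ε) / ε) / 10 ^ 7 := by
      rw [hB]
      field_simp
    have e2 : (k : ℝ) / (256 * ε) * (Real.log (1 / ε) / 4) =
        k * (Real.log (1 / ε) / ε) / 1024 := by
      field_simp
      ring
    have h2 : 0 ≤ Real.log (1 / ε) / ε := by positivity
    have h3 := mul_le_mul_of_nonneg_right h1 h2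
    have h4 : 0 ≤ k * (Real.log (1 / ε) / ε) := by positivity
    rw [e1, e2]
    linarith
  -- The matrix is fixed for the sample size `⌊B⌋₊`, which bounds every admissible `m`; smaller
  -- samples avoid a good set at least as often.
  have hmiss := two_mul_le_expected_missed (m := ⌊B⌋₊) hε0 hεC hu2' hu3 hk0.le
    ((Nat.floor_le hB0).trans hBu)
  obtain ⟨A, hA⟩ := exists_matrix hβ0.le (by linarith) hu0 hk8 hmiss hgood
  obtain ⟨H, hH, hHd⟩ := exists_superset_vcDimension_eq hdu (rowHypotheses A)
    ((card_rowHypotheses_le A).trans hLR)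
  have hu0' : (u : ℝ) ≠ 0 := by exact_mod_cast hu0.ne'
  have hD0 : ∀ _x : Fin u, 0 ≤ 1 / (u : ℝ) := fun _ => by positivity
  have hD1 : ∑ _x : Fin u, 1 / (u : ℝ) = 1 := by simp [hu0']
  refine ⟨u, H, hardLearner β (1 / 10 ^ 5) N k A, fun _ => 1 / (u : ℝ), ⟨hD0, hD1⟩, hHd, ?_, ?_⟩
  · have h := isWeakLearner_hardLearner (N := N) (k := k) (β := β) (ζ := 1 / 10 ^ 5)
      (by linarith) A hH
    rwa [show β / 4 = γ by rw [hβ]; ring] at h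
  · intro m T hm hT hmB
    refine hA.trans ((sampleProb_avoid_antitone hD0 hD1 _ (Nat.le_floor hmB.le)).trans ?_)
    exact sampleProb_mono hD0 fun x hx =>
      lt_predictionError_adaBoost hβ0 hLpos hN1 hu0 hεu A hm hT x hx
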